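/- **Setting.** Let $d\in\mathbb N$ and let $\mathcal S_0=\{\mathtt m_1<\dots<\mathtt m_d\}\subset\mathbb Z$, identified with $\mathcal S_0\times\{0\}\subset\mathbb Z^2$. Put $$\mathscr S=\{(\mathtt m_i,n): 1\le i\le d,\ n\ne 0\},\qquad \mathscr C^{\pm}_{i,k}=\{(m,n)\in\mathbb Z^2: (m-\mathtt m_i)(m-\mathtt m_k)+n^2=0,\ \pm n>0\}\quad(i<k),$$ $\mathscr C_{i,k}=\mathscr C_{i,k}^+\cup\mathscr C_{i,k}^-$ and $\mathscr C=\bigcup_{i<k}\mathscr C_{i,k}$. For $L\in\mathbb N$, the set $\mathcal S_0$ is *$L$-generic* if $\mathscr S\cap\mathscr C=\emptyset$, $\mathscr C_{i,k}\cap\mathscr C_{i',k'}=\emptyset$ for all $(i,k)\neq(i',k')$ with $i<k$, $i'<k'$, and $\sum_i\ell_i\mathtt m_i\ne0$ for all $\ell\in\mathbb Z^d$ with $0<|\ell|_1\le L$. **Admissible triples.** Fix $p>1$ and consider points $(\mathcal Y,\theta,a)\in\mathbb R^d\times\mathbb T^d\times h^p(\mathbb Z^2\setminus\mathcal S_0)$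 with the symplectic form $\sum_i d\mathcal Y_i\wedge d\theta_i+\mathrm i\sum_{j}da_j\wedge d\bar a_j$, where $h^p$ is given by $\sum_j|a_j|^2(1+|j|^2)^p<\infty$. Let $$\widetilde{\mathcal M}=\sum_i\mathcal Y_i+\sum_{j\in\mathbb Z^2\setminus(\mathcal S_0\cup\mathscr S\cup\mathscr C)}|a_j|^2,\qquad \widetilde{\mathcal P}_y=\sum_{(m,n)\in\mathbb Z^2\setminus\mathcal S_0}n\,|a_{(m,n)}|^2,$$ $$\widetilde{\mathcal P}_x=\sum_i\mathtt m_i\mathcal Y_i+\sum_{(m,n)\in\mathbb Z^2\setminus(\mathcal S_0\cup\mathscr S\cup\mathscr C)}m\,|a_{(m,n)}|^2+\sum_{i<k}\ \sum_{(m,n)\in\mathscr C_{i,k}^+}(m-\mathtt m_i)\big(|a_{(m,n)}|^2-|a_{(\mathtt m_i+\mathtt m_k-m,-n)}|^2\big).$$ A triple $(\mathbf j,\ell,\sigma)\in(\mathbb Z^2\setminus\mathcal S_0)^3\times\mathbb Z^d\times\{-1,0,1\}^3$ is *admissible* if the monomial $e^{\mathrm i\theta\cdot\ell}a_{j_1}^{\sigma_1}a_{j_2}^{\sigma_2}a_{j_3}^{\sigma_3}$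 (with $a^{+1}=a$, $a^{-1}=\bar a$, $a^0=1$) Poisson commutes with $\widetilde{\mathcal M},\widetilde{\mathcal P}_x,\widetilde{\mathcal P}_y$. It is *action preserving* if $\ell=0$ and the monomial Poisson commutes with $|a_k|^2$ for every $k\in\mathbb Z^2\setminus\mathcal S_0$. **Frequencies.** Let $\mathcal O_1\subset(0,\infty)^d$ be any set with nonempty interior on which the roots $\mu_1(\lambda),\dots,\mu_d(\lambda)$ of $$P(t,\lambda)=\prod_{i}(t+\lambda_i)-2\sum_{i}\lambda_i\prod_{k\ne i}(t+\lambda_k)$$ are pairwise distinct real continuous functions of $\lambda$ and, for each $i<k$, the two roots $\mu^{+}_{i,k}(\lambda),\mu^-_{i,k}(\lambda)$ of $$Q(t,\lambda_i,\lambda_k)=t^2-(\lambda_i-\lambda_k)t+3\lambda_i\lambda_k$$ are distinct real continuous functions of $\lambda$ (the enumeration of the roots is arbitrary). For $\varepsilon>0$ put $\omega(\lambda)=(\mathtt m_i^2-\varepsilon\lambda_i)_{1\le i\le d}$ and, for $j=(m,n)\in\mathbb Z^2\setminus\mathcal S_0$, $$\widetilde\Omega_j(\lambda,\varepsilon)=\begin{cases}m^2+n^2,&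 j\notin\mathscr S\cup\mathscr C,\\ \varepsilon\mu_i(\lambda)+n^2,& j=(\mathtt m_i,n),\ n\neq0,\\ m^2+n^2-\mathtt m_i^2+\varepsilon\mu_{i,k}^+(\lambda),& j\in\mathscr C_{i,k}^+,\\ m^2+n^2-\mathtt m_k^2-\varepsilon\mu^-_{i,k}(\lambda),& j\in\mathscr C^-_{i,k}.\end{cases}$$ **Lemma.** For every $d$ there is $L\in\mathbb N$, depending only on $d$, such that for every $L$-generic $\mathcal S_0$ with $d$ elements, every $p>1$, every $\mathcal O_1$ and every enumeration of the roots as above, every $\varepsilon>0$, and every triple $(\mathbf j,\ell,\sigma)$ that is admissible and not action preserving, the function $$\lambda\mapsto\omega(\lambda)\cdot\ell+\sigma_1\widetilde\Omega_{j_1}(\lambda,\varepsilon)+\sigma_2\widetilde\Omega_{j_2}(\lambda,\varepsilon)+\sigma_3\widetilde\Omega_{j_3}(\lambda,\varepsilon)$$ does not vanish identically on $\mathcal O_1$. -/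

import Mathlib

noncomputable section

namespace FiniteGap

/-! ### Site sets

The tangential sites are encoded by `m : Fin d → ℤ` (strictly increasing in the theorem); the
integer `m i` is identified with the lattice point `(m i, 0)`. -/

/-- The tangential set `S₀ ⊂ ℤ × {0} ⊂ ℤ²`. -/
def tangentialSites {d : ℕ} (m : Fin d → ℤ) : Set (ℤ × ℤ) :=
  {j | j.2 = 0 ∧ ∃ i, j.1 = m i}

/-- `𝒮`: the points `(m i, n)` with `n ≠ 0`. -/
def verticalSites {d : ℕ} (m : Fin d → ℤ) : Set (ℤ × ℤ) :=
  {j | j.2 ≠ 0 ∧ ∃ i, j.1 = m i}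

/-- `𝒞⁺_{i,k}`: integer points of the open upper half of the circle with diameter
`(m i, 0), (m k, 0)`. -/
def circlePlus {d : ℕ} (m : Fin d → ℤ) (i k : Fin d) : Set (ℤ × ℤ) :=
  {j | (j.1 - m i) * (j.1 - m k) + j.2 ^ 2 = 0 ∧ 0 < j.2}

/-- `𝒞⁻_{i,k}`: integer points of the open lower half of the same circle. -/
def circleMinus {d : ℕ} (m : Fin d → ℤ) (i k : Fin d) : Set (ℤ × ℤ) :=
  {j | (j.1 - m i) * (j.1 - m k) + j.2 ^ 2 = 0 ∧ j.2 < 0}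

/-- `𝒞_{i,k}`. -/
def circleSites {d : ℕ} (m : Fin d → ℤ) (i k : Fin d) : Set (ℤ × ℤ) :=
  circlePlus m i k ∪ circleMinus m i k

/-- `𝒞`: the union of the `𝒞_{i,k}` over `i < k`. -/
def allCircleSites {d : ℕ} (m : Fin d → ℤ) : Set (ℤ × ℤ) :=
  {j | ∃ i k, i < k ∧ j ∈ circleSites m i k}

/-- `ℤ² \ (S₀ ∪ 𝒮 ∪ 𝒞)`. -/
def regularSites {d : ℕ} (m : Fin d → ℤ) : Set (ℤ × ℤ) :=
  (tangentialSites m ∪ verticalSites m ∪ allCircleSites m)ᶜ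

/-- Arithmetic genericity. -/
def IsGeneric {d : ℕ} (m : Fin d → ℤ) : Prop :=
  Disjoint (verticalSites m) (allCircleSites m) ∧
    ∀ i k i' k' : Fin d, i < k → i' < k' → (i, k) ≠ (i', k') →
      Disjoint (circleSites m i k) (circleSites m i' k')

/-- `L`-genericity; `|ℓ|` is the `ℓ¹` norm. -/
def IsLGeneric {d : ℕ} (m : Fin d → ℤ) (L : ℕ) : Prop :=
  IsGeneric m ∧
    ∀ l : Fin d → ℤ, 0 < ∑ i, |l i| → ∑ i, |l i| ≤ (L : ℤ) → ∑ i, l i * m i ≠ 0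

/-! ### Phase space and Poisson bracket -/

/-- The normal sites `ℤ² \ S₀`. -/
abbrev NormalSite {d : ℕ} (m : Fin d → ℤ) : Type := {j : ℤ × ℤ // j ∉ tangentialSites m}

/-- Points `(𝒴, θ, a)`; the angles are represented by real lifts. -/
@[ext] structure PhasePoint {d : ℕ} (m : Fin d → ℤ) where
  Y : Fin d → ℝ
  θ : Fin d → ℝ
  a : NormalSite m → ℂ

/-- `a ∈ h^p(ℤ² \ S₀)`, i.e. `∑ |a_j|² ⟨j⟩^{2p} < ∞` with `⟨j⟩ = (1 + |j|²)^{1/2}`. -/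
def InPhaseSpace {d : ℕ} {m : Fin d → ℤ} (p : ℝ) (x : PhasePoint m) : Prop :=
  Summable fun j : NormalSite m =>
    ‖x.a j‖ ^ 2 * (1 + (j.1.1 : ℝ) ^ 2 + (j.1.2 : ℝ) ^ 2) ^ p

/-- `∂F/∂𝒴_i`. -/
def dY {d : ℕ} {m : Fin d → ℤ} (i : Fin d) (F : PhasePoint m → ℂ) (x : PhasePoint m) : ℂ :=
  deriv (fun t : ℝ => F { x with Y := Function.update x.Y i t }) (x.Y i)

/-- `∂F/∂θ_i`. -/
def dTheta {d : ℕ} {m : Fin d → ℤ} (i : Fin d) (F : PhasePoint m → ℂ) (x : PhasePoint m) : ℂ :=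
  deriv (fun t : ℝ => F { x with θ := Function.update x.θ i t }) (x.θ i)

/-- The real derivative of `F` in the coordinate `a_j` in the direction `v ∈ ℂ`. -/
def dDir {d : ℕ} {m : Fin d → ℤ} (j : NormalSite m) (v : ℂ) (F : PhasePoint m → ℂ)
    (x : PhasePoint m) : ℂ :=
  deriv (fun t : ℝ => F { x with a := Function.update x.a j (x.a j + t * v) }) 0

/-- The Wirtinger derivative `∂F/∂a_j`. -/
def dA {d : ℕ} {m : Fin d → ℤ} (j : NormalSite m) (F : PhasePoint m → ℂ) (x : PhasePoint m) : ℂ :=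
  (dDir j 1 F x - Complex.I * dDir j Complex.I F x) / 2

/-- The Wirtinger derivative `∂F/∂ā_j`. -/
def dAbar {d : ℕ} {m : Fin d → ℤ} (j : NormalSite m) (F : PhasePoint m → ℂ)
    (x : PhasePoint m) : ℂ :=
  (dDir j 1 F x + Complex.I * dDir j Complex.I F x) / 2

/-- The Poisson bracket `{F, G} = dF(X_G)` of the symplectic form
`∑ d𝒴_i ∧ dθ_i + i ∑ da_j ∧ dā_j`, where
`X_G = (∂_θ G, -∂_𝒴 G, -i ∂_ā G, i ∂_a G)`. -/
def poisson {d : ℕ} {m : Fin d → ℤ} (F G : PhasePoint m → ℂ) (x : PhasePoint m) : ℂ :=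
  ∑ i, (dY i F x * dTheta i G x - dTheta i F x * dY i G x) +
    ∑' j : NormalSite m, (-Complex.I * dA j F x * dAbar j G x + Complex.I * dAbar j F x * dA j G x)

/-- `F` and `G` Poisson commute on the phase space. -/
def PoissonCommute {d : ℕ} {m : Fin d → ℤ} (p : ℝ) (F G : PhasePoint m → ℂ) : Prop :=
  ∀ x : PhasePoint m, InPhaseSpace p x → poisson F G x = 0

/-- `|a_j|²`, extended by zero to `j ∈ S₀`. -/
def ampSq {d : ℕ} {m : Fin d → ℤ} (x : PhasePoint m) (j : ℤ × ℤ) : ℝ :=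
  open Classical in if h : j ∉ tangentialSites m then ‖x.a ⟨j, h⟩‖ ^ 2 else 0

/-- The action `|a_j|²` as a function on the phase space. -/
def action {d : ℕ} {m : Fin d → ℤ} (j : NormalSite m) (x : PhasePoint m) : ℂ :=
  ((‖x.a j‖ ^ 2 : ℝ) : ℂ)

/-- The mass in the final coordinates. -/
def mass {d : ℕ} {m : Fin d → ℤ} (x : PhasePoint m) : ℂ :=
  ((∑ i, x.Y i + ∑' j : regularSites m, ampSq x j : ℝ) : ℂ)

/-- The `x`-momentum in the final coordinates. -/
def momentumX {d : ℕ} {m : Fin d → ℤ} (x : PhasePoint m) : ℂ :=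
  ((∑ i, (m i : ℝ) * x.Y i + ∑' j : regularSites m, (j.1.1 : ℝ) * ampSq x j +
    ∑ q : Fin d × Fin d with q.1 < q.2, ∑' j : circlePlus m q.1 q.2,
      ((j.1.1 : ℝ) - m q.1) *
        (ampSq x j - ampSq x (m q.1 + m q.2 - j.1.1, -j.1.2)) : ℝ) : ℂ)

/-- The `y`-momentum in the final coordinates. -/
def momentumY {d : ℕ} {m : Fin d → ℤ} (x : PhasePoint m) : ℂ :=
  ((∑' j : ℤ × ℤ, (j.2 : ℝ) * ampSq x j : ℝ) : ℂ)

/-- `z^σ` with the convention `z⁺ = z`, `z⁻ = z̄`, `z⁰ = 1`. -/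
def signPow (z : ℂ) : SignType → ℂ
  | SignType.pos => z
  | SignType.neg => (starRingEnd ℂ) z
  | SignType.zero => 1

/-- The monomial `e^{i θ·ℓ} a_{j₁}^{σ₁} ⋯ a_{j_b}^{σ_b}`. -/
def monomial {d b : ℕ} {m : Fin d → ℤ} (j : Fin b → NormalSite m) (l : Fin d → ℤ)
    (σ : Fin b → SignType) (x : PhasePoint m) : ℂ :=
  Complex.exp (Complex.I * ((∑ i, x.θ i * (l i : ℝ) : ℝ) : ℂ)) *
    ∏ r, signPow (x.a (j r)) (σ r)

/-- Admissible index tuples: the monomial commutes with mass and momentum. -/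
def Admissible {d b : ℕ} {m : Fin d → ℤ} (p : ℝ) (j : Fin b → NormalSite m) (l : Fin d → ℤ)
    (σ : Fin b → SignType) : Prop :=
  PoissonCommute p (monomial j l σ) mass ∧
    PoissonCommute p (monomial j l σ) momentumX ∧
    PoissonCommute p (monomial j l σ) momentumY

/-- Action preserving index tuples: `ℓ = 0` and the monomial commutes with all actions. -/
def ActionPreserving {d b : ℕ} {m : Fin d → ℤ} (p : ℝ) (j : Fin b → NormalSite m)
    (l : Fin d → ℤ) (σ : Fin b → SignType) : Prop :=
  l = 0 ∧ ∀ k : NormalSite m, PoissonCommute p (monomial j 0 σ) (action k)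

/-! ### Frequencies -/

open Polynomial in
/-- `P(t, λ) = ∏ (t + λ_i) - 2 ∑ λ_i ∏_{k ≠ i} (t + λ_k)` as a polynomial in `t`. -/
def polyP {d : ℕ} (lam : Fin d → ℝ) : ℝ[X] :=
  ∏ i, (X + C (lam i)) - 2 * ∑ i, C (lam i) * ∏ k ∈ Finset.univ.erase i, (X + C (lam k))

open Polynomial in
/-- `Q(t, α, β) = t² - (α - β) t + 3 α β` as a polynomial in `t`. -/
def polyQ (α β : ℝ) : ℝ[X] :=
  X ^ 2 - C (α - β) * X + C (3 * α * β)

open Polynomial in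
/-- `O` is a set of parameters with nonempty interior in the positive orthant, on which the
continuous functions `μ_i` enumerate the roots of `P(·, λ)`, pairwise distinct, and, for all
`i < k`, the continuous functions `μ⁺_{i,k}, μ⁻_{i,k}` are the two roots of `Q(·, λ_i, λ_k)`,
real and distinct. -/
structure IsParameterDomain {d : ℕ} (O : Set (Fin d → ℝ))
    (μ : Fin d → (Fin d → ℝ) → ℝ) (μp μm : Fin d → Fin d → (Fin d → ℝ) → ℝ) : Prop where
  interior_nonempty : (interior O).Nonempty
  pos : ∀ lam ∈ O, ∀ i, 0 < lam i
  continuousOn : ∀ i, ContinuousOn (μ i) O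
  roots : ∀ lam ∈ O, polyP lam = ∏ i, (X - C (μ i lam))
  distinct : ∀ lam ∈ O, ∀ i k, i ≠ k → μ i lam ≠ μ k lam
  continuousOn_plus : ∀ i k, i < k → ContinuousOn (μp i k) O
  continuousOn_minus : ∀ i k, i < k → ContinuousOn (μm i k) O
  roots_pm : ∀ lam ∈ O, ∀ i k, i < k →
    polyQ (lam i) (lam k) = (X - C (μp i k lam)) * (X - C (μm i k lam))
  distinct_pm : ∀ lam ∈ O, ∀ i k, i < k → μp i k lam ≠ μm i k lam

/-- The tangential frequencies `ω_i(λ) = m_i² - ε λ_i`. -/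
def omega {d : ℕ} (m : Fin d → ℤ) (ε : ℝ) (lam : Fin d → ℝ) (i : Fin d) : ℝ :=
  (m i : ℝ) ^ 2 - ε * lam i

open Classical in
/-- The normal frequencies `Ω̃_j(λ, ε)`. For generic `m` at most one case applies to a site,
and the indices selected by `choose` are the only possible ones. -/
def normalFreq {d : ℕ} (m : Fin d → ℤ) (μ : Fin d → (Fin d → ℝ) → ℝ)
    (μp μm : Fin d → Fin d → (Fin d → ℝ) → ℝ) (ε : ℝ) (lam : Fin d → ℝ) (j : ℤ × ℤ) : ℝ :=
  if h : ∃ i : Fin d, j.2 ≠ 0 ∧ j.1 = m i then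
    ε * μ h.choose lam + (j.2 : ℝ) ^ 2
  else if h : ∃ q : Fin d × Fin d, q.1 < q.2 ∧ j ∈ circlePlus m q.1 q.2 then
    (j.1 : ℝ) ^ 2 + (j.2 : ℝ) ^ 2 - (m h.choose.1 : ℝ) ^ 2
      + ε * μp h.choose.1 h.choose.2 lam
  else if h : ∃ q : Fin d × Fin d, q.1 < q.2 ∧ j ∈ circleMinus m q.1 q.2 then
    (j.1 : ℝ) ^ 2 + (j.2 : ℝ) ^ 2 - (m h.choose.2 : ℝ) ^ 2
      - ε * μm h.choose.1 h.choose.2 lam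
  else (j.1 : ℝ) ^ 2 + (j.2 : ℝ) ^ 2

end FiniteGap

end

/-! Suppose the resonance function vanishes on `O₁`. After division by `ε` it reads κ − ℓ·λ +
(signed sum of roots) = 0, with κ independent of λ.

The first idea is to make λ complex. Choose λ ∈ `O₁` algebraically independent over ℤ[κ]. The roots
of P and Q are integral over ℤ[κ][λ], so any substitution λ ↦ z ∈ ℂ^d extends to them. Hence for
every z the relation holds for some enumeration of the roots at z
(`IsParameterDomain.exists_complex_relation`).

The second idea is to test at well-chosen z. At z = 0 all roots vanish, so κ = 0. At z = e_a + e_b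
only the roots of the circle (a,b) are not real, which forces the coefficients of its two halves to
be opposite. By Vieta the circles then contribute only linear terms in z. At z = e_0 − e_b the roots
of P are purely imaginary, so the remaining linear form is c·∑ z_i = c·∑ ρ_i. Finally P(·, z) can be
any monic polynomial of degree d, so its roots can be taken independent over ℤ, and every vertical
coefficient equals c (`typeCount_of_relation`).

The third ingredient is conservation. Evaluating the Poisson brackets at one point turns
admissibility into three linear selection rules (`Admissible.selection`). Mass conservation and the
classification give ∑ σ_r = 0, so the signs are all zero or are +1, −1, 0 in some order. In the
second case the two active sites are of the same kind, and the momenta identify them, or form one of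
two exceptional pairs that the momenta exclude. The triple is therefore action preserving. -/

namespace FiniteGap

/-! ### Algebraically independent parameters and extension of specialisations -/

/-- Ring homomorphisms into an algebraically closed field extend along integral extensions. -/
theorem exists_ringHom_extension {R S Ω : Type*} [CommRing R] [CommRing S] [IsDomain S]
    [Algebra R S] [Algebra.IsIntegral R S] [Field Ω] [IsAlgClosed Ω]
    (hinj : Function.Injective (algebraMap R S)) (f : R →+* Ω) :
    ∃ g : S →+* Ω, ∀ r, g (algebraMap R S r) = f r := by
  have := RingHom.ker_isPrime f
  -- Lying over: with Q above ker f, the domain S/Q is integral over R/ker f, which f embeds into Ω,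
  -- so S/Q maps to Ω compatibly.
  obtain ⟨Q, hQ, hQc⟩ := Ideal.exists_ideal_over_prime_of_isIntegral_of_isDomain (S := S)
    (RingHom.ker f) (by rw [(RingHom.injective_iff_ker_eq_bot _).1 hinj]; exact bot_le)
  let : Algebra R Ω := f.toAlgebra
  have hk : ∀ r ∈ Q.comap (algebraMap R S), f r = 0 := fun r hr => by
    rw [hQc] at hr; exact hr
  let : Algebra (R ⧸ Q.comap (algebraMap R S)) Ω :=
    (Ideal.Quotient.lift (Q.comap (algebraMap R S)) f hk).toAlgebra
  have h1 : Function.Injective (algebraMap (R ⧸ Q.comap (algebraMap R S)) Ω) := by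
    refine (Ideal.injective_lift_iff hk).2 hQc.symm
  have : FaithfulSMul (R ⧸ Q.comap (algebraMap R S)) Ω :=
    (faithfulSMul_iff_algebraMap_injective _ _).2 h1
  have : Module.IsTorsionFree (R ⧸ Q.comap (algebraMap R S)) (S ⧸ Q) :=
    Module.isTorsionFree_iff_algebraMap_injective.2 Ideal.algebraMap_quotient_injective
  let g : (S ⧸ Q) →ₐ[R ⧸ Q.comap (algebraMap R S)] Ω := IsAlgClosed.lift
  refine ⟨g.toRingHom.comp (Ideal.Quotient.mk Q), fun r => ?_⟩
  exact g.commutes (Ideal.Quotient.mk _ r)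

/-- Over a countable domain, algebraically independent reals can be found in any finite product of
uncountable sets. -/
theorem exists_algebraicIndependent_mem {k : Type} [CommRing k] [IsDomain k] [Countable k]
    [Algebra k ℝ] [FaithfulSMul k ℝ] (ι : Type) [Finite ι] :
    ∀ I : ι → Set ℝ, (∀ i, ¬ (I i).Countable) →
      ∃ x : ι → ℝ, AlgebraicIndependent k x ∧ ∀ i, x i ∈ I i := by
  induction ι using Finite.induction_empty_option with
  | of_equiv e ih =>
    intro I hI
    obtain ⟨x, hx, hxI⟩ := ih (I ∘ e) fun i => hI _
    refine ⟨x ∘ e.symm, hx.comp _ e.symm.injective, fun i => ?_⟩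
    simpa using hxI (e.symm i)
  | h_empty =>
    intro I _
    refine ⟨fun i => i.elim, ?_, fun i => i.elim⟩
    rw [algebraicIndependent_empty_type_iff]
    exact FaithfulSMul.algebraMap_injective k ℝ
  | @h_option α _ ih =>
    intro I hI
    obtain ⟨x, hx, hxI⟩ := ih (fun i => I (some i)) fun i => hI _
    have hc : Countable (Algebra.adjoin k (Set.range x)) := by
      rw [Algebra.adjoin_range_eq_range_aeval]
      have : Countable (MvPolynomial α k) := Cardinal.mk_le_aleph0_iff.1
        (MvPolynomial.cardinalMk_le_max.trans (by simp))
      exact (MvPolynomial.aeval x).rangeRestrict_surjective.countable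
    -- Only countably many reals are algebraic over a countable ring, and `I none` is uncountable.
    have : ∃ a ∈ I none, Transcendental (Algebra.adjoin k (Set.range x)) a := by
      by_contra! h
      refine hI none ((Algebraic.countable (Algebra.adjoin k (Set.range x)) ℝ).mono
        fun a ha => ?_)
      simpa [Transcendental] using h a ha
    obtain ⟨a, ha, hta⟩ := this
    refine ⟨fun o => o.elim a x, (hx.option_iff_transcendental a).2 hta, fun o => ?_⟩
    cases o with
    | none => exact ha
    | some i => exact hxI i

/-- Points with algebraically independent coordinates are dense. -/
theorem exists_algebraicIndependent_mem_of_interior_nonempty {k : Type} [CommRing k] [IsDomain k]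
    [Countable k] [Algebra k ℝ] [FaithfulSMul k ℝ] {d : ℕ} {O : Set (Fin d → ℝ)}
    (hO : (interior O).Nonempty) : ∃ x ∈ O, AlgebraicIndependent k x := by
  obtain ⟨y, hy⟩ := hO
  obtain ⟨δ, hδ, hb⟩ := Metric.isOpen_iff.1 isOpen_interior y hy
  obtain ⟨x, hx, hxI⟩ := exists_algebraicIndependent_mem (k := k) (Fin d)
    (fun i => Set.Ioo (y i - δ) (y i + δ)) fun i => by
      refine fun hc => absurd (Cardinal.le_aleph0_iff_set_countable.2 hc) (not_le.2 ?_)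
      rw [Cardinal.mk_Ioo_real (by linarith)]
      exact Cardinal.aleph0_lt_continuum
  refine ⟨x, interior_subset (hb ?_), hx⟩
  rw [Metric.mem_ball, dist_pi_lt_iff hδ]
  intro i
  have := hxI i
  rw [Real.dist_eq, abs_lt]
  constructor <;> linarith [this.1, this.2]

/-! ### Root systems and their specialisation to complex parameters -/

open Polynomial

/-- `ρ` lists the roots of `P(·, z)` and, for `i < k`, `νp i k`, `νm i k` are the roots of
`Q(·, z_i, z_k)`. -/
structure IsRootSystem {R : Type*} [CommRing R] {d : ℕ} (z ρ : Fin d → R)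
    (νp νm : Fin d → Fin d → R) : Prop where
  roots : ∏ i, (X + C (z i)) - 2 * ∑ i, C (z i) * ∏ k ∈ Finset.univ.erase i, (X + C (z k)) =
    ∏ i, (X - C (ρ i))
  add : ∀ i k, i < k → νp i k + νm i k = z i - z k
  mul : ∀ i k, i < k → νp i k * νm i k = 3 * z i * z k

theorem IsRootSystem.map {R R' : Type*} [CommRing R] [CommRing R'] {d : ℕ} {z ρ : Fin d → R}
    {νp νm : Fin d → Fin d → R} (h : IsRootSystem z ρ νp νm) (f : R →+* R') :
    IsRootSystem (fun i => f (z i)) (fun i => f (ρ i)) (fun i k => f (νp i k))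
      (fun i k => f (νm i k)) where
  roots := by
    have := congrArg (Polynomial.map f) h.roots
    simpa [Polynomial.map_prod, Polynomial.map_sum] using this
  add i k hik := by simpa using congrArg f (h.add i k hik)
  mul i k hik := by simpa [map_ofNat] using congrArg f (h.mul i k hik)

theorem IsRootSystem.of_map {R R' : Type*} [CommRing R] [CommRing R'] {d : ℕ} {z ρ : Fin d → R}
    {νp νm : Fin d → Fin d → R} (f : R →+* R') (hf : Function.Injective f)
    (h : IsRootSystem (fun i => f (z i)) (fun i => f (ρ i)) (fun i k => f (νp i k))
      (fun i k => f (νm i k))) : IsRootSystem z ρ νp νm where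
  roots := by
    apply Polynomial.map_injective f hf
    simpa [Polynomial.map_prod, Polynomial.map_sum] using h.roots
  add i k hik := hf (by simpa using h.add i k hik)
  mul i k hik := hf (by simpa [map_ofNat] using h.mul i k hik)

theorem IsParameterDomain.isRootSystem {d : ℕ} {O : Set (Fin d → ℝ)}
    {μ : Fin d → (Fin d → ℝ) → ℝ} {μp μm : Fin d → Fin d → (Fin d → ℝ) → ℝ}
    (h : IsParameterDomain O μ μp μm) {lam : Fin d → ℝ} (hl : lam ∈ O) :
    IsRootSystem lam (fun i => μ i lam) (fun i k => μp i k lam) (fun i k => μm i k lam) where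
  roots := h.roots lam hl
  add i k hik := by
    have h0 := congrArg (eval 0) (h.roots_pm lam hl i k hik)
    have h1 := congrArg (eval 1) (h.roots_pm lam hl i k hik)
    simp [polyQ] at h0 h1
    linarith
  mul i k hik := by
    have h0 := congrArg (eval 0) (h.roots_pm lam hl i k hik)
    simp [polyQ] at h0
    linarith

/-- The roots are integral over any ring containing the parameters. -/
theorem IsRootSystem.isIntegral {k A : Type*} [CommRing k] [CommRing A] [Algebra k A]
    {d : ℕ} {z : Fin d → k} {ρ : Fin d → A} {νp νm : Fin d → Fin d → A}
    (hinj : Function.Injective (algebraMap k A))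
    (h : IsRootSystem (fun i => algebraMap k A (z i)) ρ νp νm) :
    (∀ i, IsIntegral k (ρ i)) ∧
      ∀ a b, a < b → IsIntegral k (νp a b) ∧ IsIntegral k (νm a b) := by
  refine ⟨fun i => ?_, fun a b hab => ?_⟩
  -- The polynomial P(·, z) is monic over k because its image over A is a product of monic linear
  -- factors.
  · have hmap : (∏ i, (X + C (z i)) - 2 * ∑ i, C (z i) * ∏ k ∈ Finset.univ.erase i,
        (X + C (z k))).map (algebraMap k A) = ∏ i, (X - C (ρ i)) := by
      rw [← h.roots]
      simp [Polynomial.map_prod, Polynomial.map_sum]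
    refine ⟨_, Polynomial.monic_of_injective hinj (hmap.symm ▸
      monic_prod_of_monic _ _ fun i _ => monic_X_sub_C _), ?_⟩
    rw [← Polynomial.eval_map, hmap, Polynomial.eval_prod]
    exact Finset.prod_eq_zero (Finset.mem_univ i) (by simp)
  · have hs := h.add a b hab
    have hm := h.mul a b hab
    have hmonic : (X ^ 2 - C (z a - z b) * X + C (3 * z a * z b)).Monic := by
      by_cases hk : Nontrivial k
      · monicity!
      · rw [not_nontrivial_iff_subsingleton] at hk
        exact Subsingleton.elim _ _
    refine ⟨⟨_, hmonic, ?_⟩, ⟨_, hmonic, ?_⟩⟩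
    · simp only [eval₂_add, eval₂_sub, eval₂_mul, eval₂_pow, eval₂_X, eval₂_C]
      simp only [map_sub, map_mul, map_ofNat]
      linear_combination νp a b * hs - hm
    · simp only [eval₂_add, eval₂_sub, eval₂_mul, eval₂_pow, eval₂_X, eval₂_C]
      simp only [map_sub, map_mul, map_ofNat]
      linear_combination νm a b * hs - hm

/-- Algebraically independent reals can be specialised to arbitrary complex numbers, together with
everything integral over them. -/
theorem exists_specialization {k : Type} [CommRing k] [Algebra k ℝ] [Algebra k ℂ] {d : ℕ}
    {x : Fin d → ℝ} (hx : AlgebraicIndependent k x) (z : Fin d → ℂ) :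
    ∃ (S : Subring ℝ) (φ : S →+* ℂ),
      (∀ c : k, ∃ h : algebraMap k ℝ c ∈ S, φ ⟨_, h⟩ = algebraMap k ℂ c) ∧
      (∀ i, ∃ h : x i ∈ S, φ ⟨_, h⟩ = z i) ∧ ∀ y : ℝ, IsIntegral S y → y ∈ S := by
  let R := Algebra.adjoin k (Set.range x)
  -- Algebraic independence makes R a polynomial ring in the x_i, so evaluation at z is well
  -- defined.
  let f : R →ₐ[k] ℂ := (MvPolynomial.aeval z).comp hx.aevalEquiv.symm.toAlgHom
  have hf : ∀ i, f ⟨x i, Algebra.subset_adjoin ⟨i, rfl⟩⟩ = z i := fun i => by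
    have : hx.aevalEquiv (MvPolynomial.X i) = ⟨x i, Algebra.subset_adjoin ⟨i, rfl⟩⟩ :=
      Subtype.ext (by simp)
    simp [f, ← this]
  -- The full integral closure contains all the roots at once, so a single homomorphism specialises
  -- them consistently.
  let S := integralClosure R ℝ
  have hinj : Function.Injective (algebraMap R S) :=
    fun a b hab => Subtype.val_injective (congrArg (Subtype.val : S → ℝ) hab)
  obtain ⟨g, hg⟩ := exists_ringHom_extension hinj f.toRingHom
  refine ⟨S.toSubring, g, fun c => ⟨?_, ?_⟩, fun i => ⟨?_, ?_⟩, fun y hy => ?_⟩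
  · exact (algebraMap R S (algebraMap k R c)).2
  · exact (hg (algebraMap k R c)).trans (f.commutes c)
  · exact (algebraMap R S ⟨x i, Algebra.subset_adjoin ⟨i, rfl⟩⟩).2
  · exact (hg ⟨x i, Algebra.subset_adjoin ⟨i, rfl⟩⟩).trans (hf i)
  · have : IsIntegral S y := hy
    exact isIntegral_trans (R := R) y this

/-- The kinds of normal sites. -/
inductive SiteType (d : ℕ)
  | regular
  | vertical (i : Fin d)
  | plus (i k : Fin d)
  | minus (i k : Fin d)
  deriving DecidableEq

/-- The indices of a circle are increasing. -/
def SiteType.Valid {d : ℕ} : SiteType d → Prop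
  | regular => True
  | vertical _ => True
  | plus i k => i < k
  | minus i k => i < k

/-- The root attached to a kind of sites. -/
def SiteType.root {R : Type*} [CommRing R] {d : ℕ} (ρ : Fin d → R) (νp νm : Fin d → Fin d → R) :
    SiteType d → R
  | regular => 0
  | vertical i => ρ i
  | plus i k => νp i k
  | minus i k => -νm i k

/-- One algebraically independent λ in `O` suffices: a ring homomorphism that sends λ to z and fixes
κ carries both the root system and the relation to ℂ. The enumeration of the roots at z is not
controlled, so later arguments must work for every enumeration. -/
theorem IsParameterDomain.exists_complex_relation {d : ℕ} {O : Set (Fin d → ℝ)}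
    {μ : Fin d → (Fin d → ℝ) → ℝ} {μp μm : Fin d → Fin d → (Fin d → ℝ) → ℝ}
    (h : IsParameterDomain O μ μp μm) (κ : ℝ) (l : Fin d → ℤ) (s : Fin 3 → ℤ)
    (T : Fin 3 → SiteType d) (hT : ∀ r, (T r).Valid)
    (hrel : ∀ lam ∈ O, κ - ∑ i, (l i : ℝ) * lam i + ∑ r, (s r : ℝ) *
      (T r).root (fun i => μ i lam) (fun i k => μp i k lam) (fun i k => μm i k lam) = 0)
    (z : Fin d → ℂ) : ∃ ρ νp νm, IsRootSystem z ρ νp νm ∧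
      (κ : ℂ) - ∑ i, (l i : ℂ) * z i + ∑ r, (s r : ℂ) * (T r).root ρ νp νm = 0 := by
  -- The constant κ may be transcendental, so it is put into the base ring, which the specialisation
  -- fixes.
  let k := Algebra.adjoin ℤ {κ}
  have hk : Countable k := by
    have : Countable (ℤ[X]) := Cardinal.mk_le_aleph0_iff.1
        (Polynomial.cardinalMk_le_max.trans (by simp))
    simp only [k, Algebra.adjoin_singleton_eq_range_aeval]
    exact (aeval κ).rangeRestrict_surjective.countable
  obtain ⟨x, hxO, hx⟩ :=
    exists_algebraicIndependent_mem_of_interior_nonempty (k := k) h.interior_nonempty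
  obtain ⟨S, φ, hφk, hφx, hS⟩ := exists_specialization hx z
  obtain ⟨hκ, hφκ⟩ := hφk ⟨κ, Algebra.subset_adjoin rfl⟩
  choose hxS hφx using hφx
  have hsys := h.isRootSystem hxO
  obtain ⟨h1, h2⟩ := IsRootSystem.isIntegral (k := S) (z := fun i => ⟨x i, hxS i⟩)
    Subtype.val_injective hsys
  let ρ : Fin d → S := fun i => ⟨μ i x, hS _ (h1 i)⟩
  let νp : Fin d → Fin d → S := fun a b =>
    if hab : a < b then ⟨μp a b x, hS _ (h2 a b hab).1⟩ else 0
  let νm : Fin d → Fin d → S := fun a b =>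
    if hab : a < b then ⟨μm a b x, hS _ (h2 a b hab).2⟩ else 0
  have hsysS : IsRootSystem (fun i => (⟨x i, hxS i⟩ : S)) ρ νp νm := by
    refine IsRootSystem.of_map S.subtype Subtype.val_injective ⟨hsys.roots, ?_, ?_⟩
    · intro a b hab
      simpa [νp, νm, hab] using hsys.add a b hab
    · intro a b hab
      simpa [νp, νm, hab] using hsys.mul a b hab
  have hroot : ∀ r, S.subtype ((T r).root ρ νp νm) =
      (T r).root (fun i => μ i x) (fun i k => μp i k x) (fun i k => μm i k x) := by
    intro r
    have := hT r
    rcases hTr : T r with _ | _ | _ | _ <;> rw [hTr] at this <;>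
      simp_all [SiteType.root, ρ, νp, νm, SiteType.Valid]
  have hrootφ : ∀ r, φ ((T r).root ρ νp νm) =
      (T r).root (fun i => φ (ρ i)) (fun i k => φ (νp i k)) (fun i k => φ (νm i k)) := by
    intro r
    rcases T r with _ | _ | _ | _ <;> simp [SiteType.root]
  have hrelS : (⟨κ, hκ⟩ : S) - ∑ i, (l i : S) * ⟨x i, hxS i⟩ +
      ∑ r, (s r : S) * (T r).root ρ νp νm = 0 := by
    apply Subtype.val_injective
    have := hrel x hxO
    simp only [← hroot] at this
    simpa using this
  have hmap := hsysS.map φ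
  simp only [hφx] at hmap
  refine ⟨_, _, _, hmap, ?_⟩
  have := congrArg φ hrelS
  simp only [map_add, map_sub, map_sum, map_mul, map_intCast, hφx, map_zero, hrootφ] at this
  rw [← this]
  congr 2
  exact hφκ.symm

/-! ### The polynomial P: coefficients, Vieta and prescribed roots -/

/-- There are complex numbers linearly independent over `ℤ`. -/
theorem exists_linearIndependent_int (d : ℕ) : ∃ r : Fin d → ℂ, ∀ w : Fin d → ℤ,
    ∑ i, (w i : ℂ) * r i = 0 → w = 0 := by
  obtain ⟨x, -, hx⟩ := exists_algebraicIndependent_mem_of_interior_nonempty (k := ℤ) (d := d)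
    (O := Set.univ) (by simp)
  refine ⟨fun i => (x i : ℂ), fun w hw => ?_⟩
  have := Fintype.linearIndependent_iff.1 hx.linearIndependent w
    (by simp only [zsmul_eq_mul]; apply Complex.ofReal_injective; simpa using hw)
  exact funext this

/-- `P(·, z) = (1 - 2 d) A + 2 X A'` with `A = ∏ (X + z_i)`. -/
theorem polyP_eq_derivative {R : Type*} [CommRing R] {d : ℕ} (z : Fin d → R) :
    ∏ i, (X + C (z i)) - 2 * ∑ i, C (z i) * ∏ k ∈ Finset.univ.erase i, (X + C (z k)) =
      (1 - 2 * (d : R[X])) * ∏ i, (X + C (z i)) +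
        2 * (X * derivative (∏ i, (X + C (z i)))) := by
  have h : X * derivative (∏ i, (X + C (z i))) +
      ∑ i, C (z i) * ∏ k ∈ Finset.univ.erase i, (X + C (z k)) =
        (d : R[X]) * ∏ i, (X + C (z i)) := by
    rw [derivative_prod_finset, Finset.mul_sum, ← Finset.sum_add_distrib]
    have : ∀ i ∈ Finset.univ, X * ((∏ k ∈ Finset.univ.erase i, (X + C (z k))) *
        derivative (X + C (z i))) + C (z i) * ∏ k ∈ Finset.univ.erase i, (X + C (z k)) =
          ∏ i, (X + C (z i)) := fun i hi => by
      rw [← Finset.mul_prod_erase _ _ hi]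
      simp
      ring
    rw [Finset.sum_congr rfl this]
    simp
  linear_combination -2 * h

/-- The operator (1 − 2d) + 2X·d/dX is diagonal on monomials. Its eigenvalues are odd integers,
hence invertible over ℂ, and the one at n = d is 1. -/
theorem coeff_polyP {R : Type*} [CommRing R] {d : ℕ} (z : Fin d → R) (n : ℕ) :
    (∏ i, (X + C (z i)) - 2 * ∑ i, C (z i) * ∏ k ∈ Finset.univ.erase i, (X + C (z k))).coeff n =
      (1 - 2 * d + 2 * n) * (∏ i, (X + C (z i))).coeff n := by
  rw [polyP_eq_derivative]
  have e2 : (2 : R[X]) = C 2 := rfl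
  have e : (1 - 2 * (d : R[X])) = C (1 - 2 * (d : R)) := by simp [e2]
  rw [e, coeff_add, coeff_C_mul, e2, coeff_C_mul]
  cases n with
  | zero => simp
  | succ n =>
    rw [coeff_X_mul, coeff_derivative]
    push_cast
    ring

/-- At n = d − 1 the multiplier of `coeff_polyP` is −1, which matches the sign in Vieta's formula
for ∏ (X − ρ_i). -/
theorem IsRootSystem.sum_roots {R : Type*} [CommRing R] {d : ℕ} {z ρ : Fin d → R}
    {νp νm : Fin d → Fin d → R} (h : IsRootSystem z ρ νp νm) : ∑ i, ρ i = ∑ i, z i := by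
  rcases d with _ | d
  · simp
  have h1 := prod_X_sub_C_coeff_card_pred Finset.univ ρ (by simp)
  have h2 := prod_X_sub_C_coeff_card_pred Finset.univ (fun i => -z i) (by simp)
  have h3 := coeff_polyP z (Finset.card (Finset.univ : Finset (Fin (d + 1))) - 1)
  rw [h.roots, h1] at h3
  simp only [C_neg, sub_neg_eq_add] at h2
  rw [h2] at h3
  simp at h3
  linear_combination -h3

/-- Every monic polynomial of degree `d` over `ℂ` is of the form `P(·, z)`. -/
theorem exists_polyP_eq {d : ℕ} (r : Fin d → ℂ) : ∃ z : Fin d → ℂ,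
    ∏ i, (X + C (z i)) - 2 * ∑ i, C (z i) * ∏ k ∈ Finset.univ.erase i, (X + C (z k)) =
      ∏ i, (X - C (r i)) := by
  set q : ℂ[X] := ∏ i, (X - C (r i)) with hq
  have hqm : q.Monic := monic_prod_of_monic _ _ fun i _ => monic_X_sub_C _
  have hqd : q.natDegree = d := by simp [hq, natDegree_prod_of_monic, monic_X_sub_C]
  have hqd1 : q.coeff d = 1 := by
    have := hqm.coeff_natDegree
    rwa [hqd] at this
  have hne : ∀ n : ℕ, (1 - 2 * d + 2 * n : ℂ) ≠ 0 := fun n h => by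
    have : (1 - 2 * d + 2 * n : ℤ) = 0 := by exact_mod_cast h
    omega
  -- Dividing the coefficients of q by the multipliers gives the polynomial A = ∏ (X + z_i) to be
  -- factored over ℂ.
  set A : ℂ[X] := ∑ n ∈ Finset.range (d + 1), Polynomial.monomial n (q.coeff n / (1 - 2 * (d : ℂ) + 2 * n)) with hA
  have hAc : ∀ n, A.coeff n = q.coeff n / (1 - 2 * (d : ℂ) + 2 * n) := fun n => by
    rw [hA, finsetSum_coeff]
    simp only [coeff_monomial, Finset.sum_ite_eq', Finset.mem_range]
    split_ifs with h
    · rfl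
    · rw [coeff_eq_zero_of_natDegree_lt (by omega), zero_div]
  have hAdeg : A.natDegree ≤ d := natDegree_le_iff_coeff_eq_zero.2 fun n hn => by
    rw [hAc, coeff_eq_zero_of_natDegree_lt (by omega), zero_div]
  have hA1 : A.coeff d = 1 := by
    rw [hAc, hqd1]
    ring
  have hAm : A.Monic := monic_of_natDegree_le_of_coeff_eq_one d hAdeg hA1
  have hAd : A.natDegree = d := natDegree_eq_of_le_of_coeff_ne_zero hAdeg (by simp [hA1])
  have hsp := IsAlgClosed.splits A
  have hcard : A.roots.toList.length = d := by
    rw [Multiset.length_toList, ← hsp.natDegree_eq_card_roots, hAd]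
  have hprod : A = ∏ i : Fin d, (X + C (-(A.roots.toList.get (i.cast hcard.symm)))) := by
    have h1 := hsp.eq_prod_roots_of_monic hAm
    conv_lhs => rw [h1, ← Multiset.coe_toList A.roots, Multiset.map_coe, Multiset.prod_coe, ← List.ofFn_get (A.roots.toList), List.map_ofFn, List.prod_ofFn]
    refine Fintype.prod_equiv (finCongr hcard) _ _ fun i => ?_
    simp [sub_eq_add_neg]
  refine ⟨fun i => -(A.roots.toList.get (i.cast hcard.symm)), ?_⟩
  ext n
  rw [coeff_polyP, ← hprod, hAc, mul_div_cancel₀ _ (hne n)]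

/-- If `P(·, z)` has prescribed roots `r`, linearly independent over `ℤ`, then an integer relation
between the roots is trivial. -/
theorem eq_zero_of_forall_root_relation {d : ℕ} (w : Fin d → ℤ)
    (H : ∀ z : Fin d → ℂ, ∃ ρ νp νm, IsRootSystem z ρ νp νm ∧ ∑ i, (w i : ℂ) * ρ i = 0) :
    w = 0 := by
  obtain ⟨r, hr⟩ := exists_linearIndependent_int d
  obtain ⟨z, hz⟩ := exists_polyP_eq r
  obtain ⟨ρ, νp, νm, hsys, hw⟩ := H z
  have hrinj : Function.Injective r := fun i k hik => by
    by_contra hne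
    have := congrFun (hr (Pi.single i 1 - Pi.single k 1)
      (by simp [sub_mul, Finset.sum_sub_distrib, Pi.single_apply, hik])) i
    simp [hne] at this
  -- The roots ρ are the r_i in an unknown order; equality of multisets supplies the permutation.
  have hms : Finset.univ.val.map ρ = Finset.univ.val.map r := by
    have h1 := congrArg Polynomial.roots (hsys.roots.symm.trans hz)
    have h2 : ∀ f : Fin d → ℂ, (∏ i, (X - C (f i))).roots = Finset.univ.val.map f := fun f => by
      rw [← roots_multiset_prod_X_sub_C (Finset.univ.val.map f), Multiset.map_map]
      rfl
    rwa [h2, h2] at h1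
  have hρinj : Function.Injective ρ := fun i k hik =>
    Multiset.inj_on_of_nodup_map (hms ▸ Finset.univ.nodup.map hrinj) i (Finset.mem_univ i) k
      (Finset.mem_univ k) hik
  have hmem : ∀ i, ∃ k, r k = ρ i := fun i => by
    have : ρ i ∈ Finset.univ.val.map r := hms ▸ Multiset.mem_map_of_mem ρ (Finset.mem_univ i)
    simpa using this
  choose e he using hmem
  have hebij : Function.Bijective e := Finite.injective_iff_bijective.1 fun i k hik =>
    hρinj (by rw [← he, ← he, hik])
  let E := Equiv.ofBijective e hebij
  have hzero := hr (w ∘ E.symm) (by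
    rw [← hw]
    refine Fintype.sum_equiv E.symm _ _ fun i => ?_
    rw [← he]
    simp [← show E (E.symm i) = e (E.symm i) from rfl])
  funext i
  simpa using congrFun hzero (E i)

/-- The roots of `P(·, z)` when at most two coordinates of `z` do not vanish. -/
theorem IsRootSystem.root_two {d : ℕ} {a b : Fin d} (hab : a ≠ b) {x y : ℂ} {ρ : Fin d → ℂ}
    {νp νm : Fin d → Fin d → ℂ} (h : IsRootSystem (Pi.single a x + Pi.single b y) ρ νp νm)
    (i : Fin d) : ρ i = 0 ∨
      (ρ i + x) * (ρ i + y) - 2 * x * (ρ i + y) - 2 * y * (ρ i + x) = 0 := by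
  set t := ρ i
  set z : Fin d → ℂ := Pi.single a x + Pi.single b y with hz
  have hza : z a = x := by simp [hz, hab]
  have hzb : z b = y := by simp [hz, hab.symm]
  have hzo : ∀ k, k ≠ a ∧ k ≠ b → z k = 0 := fun k hk => by simp [hz, hk.1, hk.2]
  have hev := congrArg (eval t) h.roots
  have hev0 : eval t (∏ i, (X - C (ρ i))) = 0 := by
    rw [eval_prod]
    exact Finset.prod_eq_zero (Finset.mem_univ i) (by simp [t])
  rw [hev0] at hev
  simp only [eval_sub, eval_mul, eval_prod, eval_add, eval_X, eval_C, eval_ofNat,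
    eval_finsetSum] at hev
  rw [Finset.sum_eq_add a b hab (fun k _ hk => by rw [hzo k hk, zero_mul]) (by simp) (by simp)]
    at hev
  set E := ∏ k ∈ (Finset.univ.erase a).erase b, (t + z k) with hE
  have ha : ∏ k ∈ Finset.univ.erase a, (t + z k) = (t + y) * E := by
    rw [← Finset.mul_prod_erase _ _ (show b ∈ Finset.univ.erase a by simp [hab.symm]), hzb]
  have hb : ∏ k ∈ Finset.univ.erase b, (t + z k) = (t + x) * E := by
    rw [← Finset.mul_prod_erase _ _ (show a ∈ Finset.univ.erase b by simp [hab]), hza,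
      Finset.erase_right_comm]
  have hall : ∏ k, (t + z k) = (t + x) * ((t + y) * E) := by
    rw [← Finset.mul_prod_erase _ _ (Finset.mem_univ a), hza, ha]
  -- The other coordinates vanish, so the remaining factors are all t: a root is 0 or a zero of the
  -- quadratic factor.
  have hEt : E = t ^ ((Finset.univ.erase a).erase b).card := by
    rw [hE]
    refine Finset.prod_eq_pow_card fun k hk => ?_
    simp only [Finset.mem_erase, Finset.mem_univ, and_true] at hk
    rw [hzo k ⟨hk.2, hk.1⟩, add_zero]
  rw [hall, ha, hb, hza, hzb] at hev
  have : E * ((t + x) * (t + y) - 2 * x * (t + y) - 2 * y * (t + x)) = 0 := by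
    linear_combination hev
  rcases mul_eq_zero.1 this with h0 | h0
  · rw [hEt] at h0
    exact Or.inl (eq_zero_of_pow_eq_zero h0)
  · exact Or.inr h0

/-! ### Classification of integer relations between the roots -/

/-- The total coefficient of the entries of kind `t`. -/
def typeCount {d : ℕ} (s : Fin 3 → ℤ) (T : Fin 3 → SiteType d) (t : SiteType d) : ℤ :=
  ∑ r, if T r = t then s r else 0

theorem SiteType.root_eq_sum {d : ℕ} (ρ : Fin d → ℂ) (νp νm : Fin d → Fin d → ℂ)
    (t : SiteType d) : t.root ρ νp νm = ∑ i, (if t = .vertical i then 1 else 0) * ρ i +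
      ∑ a, ∑ b, ((if t = .plus a b then 1 else 0) * νp a b -
        (if t = .minus a b then 1 else 0) * νm a b) := by
  cases t <;> simp [SiteType.root, ite_and]

/-- Grouping the three terms by kind exposes the integer coefficient of each root, whatever
coincidences occur among the kinds. -/
theorem sum_root_eq {d : ℕ} (s : Fin 3 → ℤ) (T : Fin 3 → SiteType d) (ρ : Fin d → ℂ)
    (νp νm : Fin d → Fin d → ℂ) : ∑ r, (s r : ℂ) * (T r).root ρ νp νm =
      ∑ i, (typeCount s T (.vertical i) : ℂ) * ρ i +
        ∑ a, ∑ b, ((typeCount s T (.plus a b) : ℂ) * νp a b -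
          (typeCount s T (.minus a b) : ℂ) * νm a b) := by
  simp only [SiteType.root_eq_sum, typeCount, Int.cast_sum, Int.cast_ite, Int.cast_zero, mul_add,
    Finset.mul_sum, Finset.sum_mul, Finset.sum_add_distrib, ← Finset.sum_sub_distrib]
  rw [Finset.sum_comm]
  congr 1
  · exact Finset.sum_congr rfl fun _ _ => Finset.sum_congr rfl fun _ _ => by split_ifs <;> ring
  · rw [Finset.sum_comm]
    refine Finset.sum_congr rfl fun _ _ => ?_
    rw [Finset.sum_comm]
    exact Finset.sum_congr rfl fun _ _ => Finset.sum_congr rfl fun _ _ => by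
      split_ifs <;> ring

theorem typeCount_plus_eq_zero {d : ℕ} (s : Fin 3 → ℤ) {T : Fin 3 → SiteType d}
    (hT : ∀ r, (T r).Valid) {a b : Fin d} (hab : ¬ a < b) :
    typeCount s T (.plus a b) = 0 ∧ typeCount s T (.minus a b) = 0 := by
  constructor <;> refine Finset.sum_eq_zero fun r _ => if_neg fun h => ?_ <;>
    exact hab (by simpa [h, SiteType.Valid] using hT r)

section

variable {d : ℕ} {l : Fin d → ℤ} {s : Fin 3 → ℤ} {T : Fin 3 → SiteType d}

/-- The square roots coming from the circles are independent of the roots of `P`. -/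
theorem typeCount_plus_add_minus (hT : ∀ r, (T r).Valid)
    (H : ∀ z : Fin d → ℂ, ∃ ρ νp νm, IsRootSystem z ρ νp νm ∧
      ∑ r, (s r : ℂ) * (T r).root ρ νp νm = ∑ i, (l i : ℂ) * z i) {a b : Fin d} (hab : a < b) :
    typeCount s T (.plus a b) + typeCount s T (.minus a b) = 0 := by
  -- Here the roots of P lie in {0, −1, 3}, while Q for (a,b) is t² + 3, with roots ±i√3.
  obtain ⟨ρ, νp, νm, hsys, hrel⟩ := H (Pi.single a 1 + Pi.single b 1)
  have hρ : ∀ i, (ρ i).im = 0 := fun i => by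
    rcases hsys.root_two hab.ne i with h | h
    · simp [h]
    · have : (ρ i + 1) * (ρ i - 3) = 0 := by linear_combination h
      rcases mul_eq_zero.1 this with h | h
      · rw [eq_neg_of_add_eq_zero_left h]; simp
      · rw [sub_eq_zero.1 h]; simp
  have hab1 := hsys.add a b hab
  have hab2 := hsys.mul a b hab
  simp only [Pi.add_apply, Pi.single_eq_same, Pi.single_eq_of_ne hab.ne,
    Pi.single_eq_of_ne hab.ne', add_zero, zero_add, mul_one, sub_self] at hab1 hab2
  have hne : (νp a b).im ≠ 0 := fun h0 => by
    have h3 : νp a b * νp a b = -3 := by linear_combination νp a b * hab1 - hab2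
    have := congrArg Complex.re h3
    simp [h0] at this
    nlinarith [mul_self_nonneg (νp a b).re]
  -- Any other circle has a vanishing parameter, so its roots are 0 and the real number z_i − z_k.
  have hother : ∀ i k, i < k → (i, k) ≠ (a, b) → (νp i k).im = 0 ∧ (νm i k).im = 0 := by
    intro i k hik hne
    have h1 := hsys.add i k hik
    have h2 := hsys.mul i k hik
    set z : Fin d → ℂ := Pi.single a 1 + Pi.single b 1 with hz
    have hzim : ∀ i, (z i).im = 0 := fun i => by
      simp only [hz, Pi.add_apply, Pi.single_apply]
      split_ifs <;> simp
    have hz0 : z i = 0 ∨ z k = 0 := by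
      by_contra! hcon
      have hi : i = a ∨ i = b := by
        by_contra! h
        exact hcon.1 (by simp [hz, h.1, h.2])
      have hk : k = a ∨ k = b := by
        by_contra! h
        exact hcon.2 (by simp [hz, h.1, h.2])
      rcases hi with rfl | rfl <;> rcases hk with rfl | rfl
      · exact hik.ne rfl
      · exact hne rfl
      · exact absurd hik hab.asymm
      · exact hik.ne rfl
    have h3 : νp i k * νm i k = 0 := by
      rw [h2]; rcases hz0 with h | h <;> simp [h]
    have h1im := congrArg Complex.im h1
    simp only [Complex.add_im, Complex.sub_im, hzim, sub_zero] at h1im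
    rcases mul_eq_zero.1 h3 with h | h <;> simp [h] at h1im ⊢ <;> exact h1im
  have him := congrArg Complex.im hrel
  have hr : ∀ i, (((l i : ℂ)) * ((Pi.single a 1 + Pi.single b 1 : Fin d → ℂ) i)).im = 0 :=
    fun i => by
      simp only [Pi.add_apply, Pi.single_apply]
      split_ifs <;> simp
  rw [sum_root_eq, Complex.add_im, Complex.im_sum, Complex.im_sum, Complex.im_sum,
    Finset.sum_eq_zero (fun i _ => hr i), Finset.sum_eq_zero (fun i _ => by simp [hρ i]),
    zero_add, Finset.sum_eq_single a, Complex.im_sum, Finset.sum_eq_single b] at him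
  · rw [← eq_neg_iff_add_eq_zero] at hab1
    rw [hab1] at him hne
    have h2 : ((typeCount s T (.plus a b) + typeCount s T (.minus a b) : ℤ) : ℝ) *
        (νm a b).im = 0 := by
      simp at him
      push_cast
      linarith
    rcases mul_eq_zero.1 h2 with h | h
    · exact_mod_cast h
    · simp [h] at hne
  · intro k _ hk
    by_cases hak : a < k
    · obtain ⟨h1, h2⟩ := hother a k hak (by simp [hk])
      simp [h1, h2]
    · simp [typeCount_plus_eq_zero s hT hak]
  · simp
  · intro i _ hi
    rw [Complex.im_sum]
    refine Finset.sum_eq_zero fun k _ => ?_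
    by_cases hik : i < k
    · obtain ⟨h1, h2⟩ := hother i k hik (by simp [hi])
      simp [h1, h2]
    · simp [typeCount_plus_eq_zero s hT hik]
  · simp

/-- Classification of the linear relations between the roots. -/
theorem typeCount_of_relation (hT : ∀ r, (T r).Valid)
    (H : ∀ z : Fin d → ℂ, ∃ ρ νp νm, IsRootSystem z ρ νp νm ∧
      ∑ r, (s r : ℂ) * (T r).root ρ νp νm = ∑ i, (l i : ℂ) * z i) :
    ∃ c : ℤ, (∀ i, typeCount s T (.vertical i) = c) ∧
      ∀ i, l i = c + ∑ k, (typeCount s T (.plus i k) - typeCount s T (.plus k i)) := by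
  set h : Fin d → ℤ := fun i => ∑ k, (typeCount s T (.plus i k) - typeCount s T (.plus k i))
    with hh
  have H' : ∀ z : Fin d → ℂ, ∃ ρ νp νm, IsRootSystem z ρ νp νm ∧
      ∑ i, (typeCount s T (.vertical i) : ℂ) * ρ i = ∑ i, ((l i - h i : ℤ) : ℂ) * z i := by
    intro z
    obtain ⟨ρ, νp, νm, hsys, hrel⟩ := H z
    refine ⟨ρ, νp, νm, hsys, ?_⟩
    -- Opposite coefficients leave a multiple of ν⁺ + ν⁻ = z_a − z_b, so the circles become part of
    -- the linear form.
    have hc : ∀ a b, (typeCount s T (.plus a b) : ℂ) * νp a b -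
        (typeCount s T (.minus a b) : ℂ) * νm a b =
          (typeCount s T (.plus a b) : ℂ) * z a - (typeCount s T (.plus a b) : ℂ) * z b := by
      intro a b
      by_cases hab : a < b
      · have h1 := typeCount_plus_add_minus hT H hab
        have h2 : (typeCount s T (.plus a b) : ℂ) + typeCount s T (.minus a b) = 0 := by
          exact_mod_cast h1
        linear_combination (typeCount s T (.plus a b) : ℂ) * hsys.add a b hab - νm a b * h2
      · simp [typeCount_plus_eq_zero s hT hab]
    rw [sum_root_eq] at hrel
    simp only [hc, Finset.sum_sub_distrib] at hrel
    rw [Finset.sum_comm (f := fun a b => (typeCount s T (.plus a b) : ℂ) * z b)] at hrel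
    simp only [hh, Int.cast_sub, Int.cast_sum, sub_mul, Finset.sum_sub_distrib, Finset.sum_mul]
    linear_combination hrel
  rcases d with _ | d
  · exact ⟨0, fun i => i.elim0, fun i => i.elim0⟩
  have hconst : ∀ i, l i - h i = l 0 - h 0 := by
    intro b
    by_cases hab : b = 0
    · rw [hab]
    -- Now every root of P is 0 or ±i√3, so real parts compare the coefficients of z_0 and z_b.
    obtain ⟨ρ, νp, νm, hsys, hrel⟩ := H' (Pi.single 0 1 + Pi.single b (-1))
    have hρ : ∀ i, (ρ i).re = 0 := fun i => by
      rcases hsys.root_two (Ne.symm hab) i with h | h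
      · simp [h]
      · have h3 : ρ i * ρ i = -3 := by linear_combination h
        have h4 := congrArg Complex.re h3
        have h5 := congrArg Complex.im h3
        simp at h4 h5
        have h6 : (ρ i).re * (ρ i).im = 0 := by linarith
        rcases mul_eq_zero.1 h6 with h6 | h6
        · exact h6
        · rw [h6] at h4
          nlinarith [mul_self_nonneg (ρ i).re]
    have hre := congrArg Complex.re hrel
    rw [Complex.re_sum, Finset.sum_eq_zero (fun i _ => by simp [hρ i]), Complex.re_sum,
      Finset.sum_eq_add 0 b (Ne.symm hab) (fun k _ hk => by simp [hk.1, hk.2]) (by simp)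
        (by simp)] at hre
    simp [hab, Ne.symm hab] at hre
    have : (l b - h b : ℝ) = (l 0 - h 0 : ℝ) := by linarith
    exact_mod_cast this
  refine ⟨l 0 - h 0, fun i => ?_, fun i => by rw [← hconst i]; ring⟩
  -- The linear form is c·∑ z_i = c·∑ ρ_i, so it can be absorbed into the coefficients of the roots.
  have hw := eq_zero_of_forall_root_relation
    (fun i => typeCount s T (.vertical i) - (l 0 - h 0)) fun z => by
      obtain ⟨ρ, νp, νm, hsys, hrel⟩ := H' z
      refine ⟨ρ, νp, νm, hsys, ?_⟩
      simp only [hconst, ← Finset.mul_sum, ← hsys.sum_roots] at hrel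
      simp only [Int.cast_sub _ (l 0 - h 0), sub_mul, Finset.sum_sub_distrib, ← Finset.mul_sum]
      rw [hrel, sub_self]
  have := congrFun hw i
  simp only [Pi.zero_apply] at this
  linarith

end

/-- The constant term of a relation vanishes. -/
theorem constant_eq_zero_of_relation {d : ℕ} {κ : ℝ} {l : Fin d → ℤ} {s : Fin 3 → ℤ}
    {T : Fin 3 → SiteType d} (hT : ∀ r, (T r).Valid)
    (H : ∀ z : Fin d → ℂ, ∃ ρ νp νm, IsRootSystem z ρ νp νm ∧
      (κ : ℂ) - ∑ i, (l i : ℂ) * z i + ∑ r, (s r : ℂ) * (T r).root ρ νp νm = 0) : κ = 0 := by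
  obtain ⟨ρ, νp, νm, hsys, hrel⟩ := H 0
  have hρ : ∀ i, ρ i = 0 := fun i => by
    have hev := congrArg (eval (ρ i)) hsys.roots
    have hev0 : eval (ρ i) (∏ i, (X - C (ρ i))) = 0 := by
      rw [eval_prod]
      exact Finset.prod_eq_zero (Finset.mem_univ i) (by simp)
    rw [hev0] at hev
    simp at hev
    exact hev.1
  have hν : ∀ a b, a < b → νp a b = 0 ∧ νm a b = 0 := fun a b hab => by
    have h1 := hsys.add a b hab
    have h2 := hsys.mul a b hab
    simp only [Pi.zero_apply, sub_self, mul_zero] at h1 h2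
    rcases mul_eq_zero.1 h2 with h | h <;> simp_all
  have hroot : ∀ r, (T r).root ρ νp νm = 0 := fun r => by
    have := hT r
    rcases hTr : T r with _ | _ | _ | _ <;> rw [hTr] at this
    · rfl
    · exact hρ _
    · exact (hν _ _ this).1
    · simp [SiteType.root, (hν _ _ this).2]
  simpa [hroot] using hrel

/-! ### Poisson brackets of monomials with functions of the actions -/

section Poisson

variable {d b : ℕ} {m : Fin d → ℤ}

/-- The derivative of `z ↦ z^σ` in the direction `v`. -/
def signPowDir (v : ℂ) : SignType → ℂ
  | SignType.pos => v
  | SignType.neg => (starRingEnd ℂ) v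
  | SignType.zero => 0

theorem hasDerivAt_add_ofReal_mul (z v : ℂ) :
    HasDerivAt (fun t : ℝ => z + t * v) v 0 := by
  simpa using ((Complex.ofRealCLM.hasDerivAt (x := (0 : ℝ))).mul_const v).const_add z

theorem hasDerivAt_conj_add_ofReal_mul (z v : ℂ) :
    HasDerivAt (fun t : ℝ => (starRingEnd ℂ) (z + t * v)) ((starRingEnd ℂ) v) 0 := by
  simpa only [map_add, map_mul, Complex.conj_ofReal] using
    hasDerivAt_add_ofReal_mul ((starRingEnd ℂ) z) ((starRingEnd ℂ) v)

theorem hasDerivAt_signPow (z v : ℂ) (s : SignType) :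
    HasDerivAt (fun t : ℝ => signPow (z + t * v) s) (signPowDir v s) 0 := by
  cases s with
  | pos => exact hasDerivAt_add_ofReal_mul z v
  | neg => exact hasDerivAt_conj_add_ofReal_mul z v
  | zero => exact hasDerivAt_const _ _

theorem dDir_monomial (j : Fin b → NormalSite m) (l : Fin d → ℤ) (σ : Fin b → SignType)
    (x : PhasePoint m) (k : NormalSite m) (v : ℂ) :
    dDir k v (monomial j l σ) x =
      Complex.exp (Complex.I * ((∑ i, x.θ i * (l i : ℝ) : ℝ) : ℂ)) *
        ∑ r, (∏ s ∈ Finset.univ.erase r, signPow (x.a (j s)) (σ s)) *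
          (if j r = k then signPowDir v (σ r) else 0) := by
  have h : ∀ r ∈ Finset.univ, HasDerivAt (fun t : ℝ =>
      signPow (Function.update x.a k (x.a k + t * v) (j r)) (σ r))
      (if j r = k then signPowDir v (σ r) else 0) 0 := fun r _ => by
    split_ifs with hr
    · subst hr
      simpa using hasDerivAt_signPow (x.a (j r)) v (σ r)
    · simpa [Function.update_of_ne hr] using hasDerivAt_const (0 : ℝ) _
  have hp := (HasDerivAt.fun_finsetProd h).const_mul
    (Complex.exp (Complex.I * ((∑ i, x.θ i * (l i : ℝ) : ℝ) : ℂ)))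
  simpa [dDir, monomial] using hp.deriv

/-- The operator a∂_a − ā∂_ā generates the rotation of a_k; a monomial is an eigenvector, with
eigenvalue the sum of its signs at k. -/
theorem dA_monomial_mul_sub (j : Fin b → NormalSite m) (l : Fin d → ℤ) (σ : Fin b → SignType)
    (x : PhasePoint m) (k : NormalSite m) :
    dA k (monomial j l σ) x * x.a k - dAbar k (monomial j l σ) x * (starRingEnd ℂ) (x.a k) =
      (∑ r, if j r = k then ((σ r : ℤ) : ℂ) else 0) * monomial j l σ x := by
  rw [dA, dAbar, dDir_monomial, dDir_monomial, monomial]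
  set e := Complex.exp (Complex.I * ((∑ i, x.θ i * (l i : ℝ) : ℝ) : ℂ))
  have hterm : ∀ r, ((∏ s ∈ Finset.univ.erase r, signPow (x.a (j s)) (σ s)) *
        (if j r = k then signPowDir 1 (σ r) else 0) - Complex.I *
      ((∏ s ∈ Finset.univ.erase r, signPow (x.a (j s)) (σ s)) *
        (if j r = k then signPowDir Complex.I (σ r) else 0))) * x.a k -
      ((∏ s ∈ Finset.univ.erase r, signPow (x.a (j s)) (σ s)) *
        (if j r = k then signPowDir 1 (σ r) else 0) + Complex.I *
      ((∏ s ∈ Finset.univ.erase r, signPow (x.a (j s)) (σ s)) *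
        (if j r = k then signPowDir Complex.I (σ r) else 0))) * (starRingEnd ℂ) (x.a k) =
      2 * ((if j r = k then ((σ r : ℤ) : ℂ) else 0) * ∏ r, signPow (x.a (j r)) (σ r)) := by
    intro r
    rw [← Finset.mul_prod_erase _ _ (Finset.mem_univ r)]
    generalize ∏ s ∈ Finset.univ.erase r, signPow (x.a (j s)) (σ s) = E
    split_ifs with hr
    · subst hr
      have hI := Complex.I_mul_I
      rcases hσ : σ r with _ | _ | _
      · simp [signPowDir, signPow]
      · simp [signPowDir, signPow]
        linear_combination (E *
          (x.a (j r) + (starRingEnd ℂ) (x.a (j r)))) * hI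
      · simp [signPowDir, signPow]
        linear_combination -(E *
          (x.a (j r) + (starRingEnd ℂ) (x.a (j r)))) * hI
    · simp
  have hsum := Finset.sum_congr rfl fun r (_ : r ∈ Finset.univ) => hterm r
  simp only [Finset.sum_sub_distrib, Finset.sum_add_distrib, ← Finset.sum_mul,
    ← Finset.mul_sum] at hsum
  linear_combination e / 2 * hsum

/-- At `x`, the function `F` has the first derivatives of `∑ c_i 𝒴_i + ∑ W_k |a_k|²`. -/
structure HasActionGradient (F : PhasePoint m → ℂ) (c : Fin d → ℝ) (W : NormalSite m → ℝ)
    (x : PhasePoint m) : Prop where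
  dY : ∀ i, dY i F x = c i
  dTheta : ∀ i, dTheta i F x = 0
  dA : ∀ k, dA k F x = W k * (starRingEnd ℂ) (x.a k)
  dAbar : ∀ k, dAbar k F x = W k * x.a k

theorem dTheta_monomial (j : Fin b → NormalSite m) (l : Fin d → ℤ) (σ : Fin b → SignType)
    (x : PhasePoint m) (i : Fin d) :
    dTheta i (monomial j l σ) x = Complex.I * (l i : ℂ) * monomial j l σ x := by
  have h : ∀ t : ℝ, ∑ k, Function.update x.θ i t k * (l k : ℝ) =
      t * l i + ∑ k ∈ Finset.univ.erase i, x.θ k * (l k : ℝ) := fun t => by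
    rw [← Finset.add_sum_erase _ _ (Finset.mem_univ i), Function.update_self]
    congr 1
    exact Finset.sum_congr rfl fun k hk => by rw [Function.update_of_ne (Finset.ne_of_mem_erase hk)]
  have h0 := h (x.θ i)
  rw [Function.update_eq_self] at h0
  simp only [dTheta, monomial, h]
  rw [h0]
  set B := ∑ k ∈ Finset.univ.erase i, x.θ k * (l k : ℝ)
  have h1 : HasDerivAt (fun t : ℝ => Complex.I * ((t * l i + B : ℝ) : ℂ))
      (Complex.I * (l i : ℂ)) (x.θ i) := by
    have := (((hasDerivAt_id (x.θ i)).mul_const (l i : ℝ)).add_const B).ofReal_comp.const_mul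
      Complex.I
    simpa using this
  have h2 := h1.cexp.mul_const (∏ r, signPow (x.a (j r)) (σ r))
  rw [h2.deriv]
  ring

/-- A function with such a gradient rotates each phase at constant speed to first order, so its
bracket multiplies the monomial by a scalar. That scalar is the selection rule. -/
theorem poisson_monomial {F : PhasePoint m → ℂ} {c : Fin d → ℝ} {W : NormalSite m → ℝ}
    {x : PhasePoint m} (hF : HasActionGradient F c W x) (j : Fin b → NormalSite m)
    (l : Fin d → ℤ) (σ : Fin b → SignType) :
    poisson (monomial j l σ) F x =
      -Complex.I * ((∑ i, (l i : ℝ) * c i + ∑ r, ((σ r : ℤ) : ℝ) * W (j r) : ℝ) : ℂ) *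
        monomial j l σ x := by
  have hY : ∀ i, dY i (monomial j l σ) x = 0 := fun i => by simp [FiniteGap.dY, monomial]
  have hk : ∀ k, -Complex.I * dA k (monomial j l σ) x * dAbar k F x +
      Complex.I * dAbar k (monomial j l σ) x * dA k F x =
        ∑ r, -Complex.I * monomial j l σ x * (if k = j r then ((σ r : ℤ) : ℂ) * W (j r) else 0) := by
    intro k
    have h1 := dA_monomial_mul_sub j l σ x k
    have h2 : ∑ r, (if k = j r then ((σ r : ℤ) : ℂ) * W (j r) else 0) =
        W k * ∑ r, if j r = k then ((σ r : ℤ) : ℂ) else 0 := by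
      rw [Finset.mul_sum]
      refine Finset.sum_congr rfl fun r _ => ?_
      by_cases h : j r = k
      · rw [if_pos h, if_pos h.symm, h, mul_comm]
      · rw [if_neg h, if_neg (Ne.symm h), mul_zero]
    rw [hF.dA, hF.dAbar, ← Finset.mul_sum, h2]
    linear_combination -Complex.I * W k * h1
  simp only [poisson, hY, hF.dTheta, hF.dY, dTheta_monomial, hk]
  rw [Summable.tsum_finsetSum fun r _ => summable_of_ne_finset_zero (s := {j r}) fun k hk => by
    rw [if_neg (by simpa using hk), mul_zero]]
  simp only [tsum_mul_left, tsum_ite_eq]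
  simp only [Complex.ofReal_add, Complex.ofReal_sum, Complex.ofReal_mul, Complex.ofReal_intCast]
  rw [mul_add, add_mul, Finset.mul_sum, Finset.mul_sum, Finset.sum_mul, Finset.sum_mul]
  congr 1
  · exact Finset.sum_congr rfl fun i _ => by ring
  · exact Finset.sum_congr rfl fun r _ => by ring

/-- The gradient sees one coordinate at a time, so it is enough to know F along each coordinate
separately. -/
theorem hasActionGradient_of_eq {F : PhasePoint m → ℂ} {c : Fin d → ℝ} {W : NormalSite m → ℝ}
    {x : PhasePoint m} {B : ℝ}
    (hY : ∀ y, F { x with Y := y } = ((∑ i, c i * y i + B : ℝ) : ℂ))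
    (hθ : ∀ θ, F { x with θ := θ } = F x)
    (ha : ∀ k, ∃ A : ℝ, ∀ w, F { x with a := Function.update x.a k w } =
      ((A + W k * ‖w‖ ^ 2 : ℝ) : ℂ)) : HasActionGradient F c W x := by
  have hdir : ∀ k v, dDir k v F x =
      W k * (x.a k * (starRingEnd ℂ) v + (starRingEnd ℂ) (x.a k) * v) := by
    intro k v
    obtain ⟨A, hA⟩ := ha k
    simp only [dDir, hA]
    have h : ∀ t : ℝ, ((A + W k * ‖x.a k + t * v‖ ^ 2 : ℝ) : ℂ) =
        A + W k * ((x.a k + t * v) * (starRingEnd ℂ) (x.a k + t * v)) := fun t => by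
      rw [Complex.mul_conj, Complex.normSq_eq_norm_sq]
      push_cast
      rfl
    simp only [h]
    have h1 := hasDerivAt_add_ofReal_mul (x.a k) v
    have h2 := hasDerivAt_conj_add_ofReal_mul (x.a k) v
    have h3 := ((h1.mul h2).const_mul (W k : ℂ)).const_add (A : ℂ)
    have := h3.deriv
    simp only [Pi.mul_apply] at this
    rw [this, Complex.ofReal_zero, zero_mul, add_zero]
    ring
  refine ⟨fun i => ?_, fun i => ?_, fun k => ?_, fun k => ?_⟩
  · simp only [FiniteGap.dY, hY]
    have h : ∀ t : ℝ, ∑ k, c k * Function.update x.Y i t k + B =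
        c i * t + (∑ k ∈ Finset.univ.erase i, c k * x.Y k + B) := fun t => by
      rw [← Finset.add_sum_erase _ _ (Finset.mem_univ i), Function.update_self, add_assoc]
      congr 2
      exact Finset.sum_congr rfl fun k hk => by
        rw [Function.update_of_ne (Finset.ne_of_mem_erase hk)]
    simp only [h]
    have := (((hasDerivAt_id (x.Y i)).const_mul (c i)).add_const
      (∑ k ∈ Finset.univ.erase i, c k * x.Y k + B)).ofReal_comp.deriv
    simpa using this
  · simp only [FiniteGap.dTheta, hθ]
    exact deriv_const _ _
  · rw [FiniteGap.dA, hdir, hdir]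
    simp
    linear_combination (W k * (x.a k - (starRingEnd ℂ) (x.a k)) / 2 : ℂ) * Complex.I_mul_I
  · rw [FiniteGap.dAbar, hdir, hdir]
    simp
    linear_combination (W k * ((starRingEnd ℂ) (x.a k) - x.a k) / 2 : ℂ) * Complex.I_mul_I

theorem hasActionGradient_action (k : NormalSite m) (x : PhasePoint m) :
    HasActionGradient (action k) 0 (Pi.single k 1) x := by
  refine hasActionGradient_of_eq (B := ‖x.a k‖ ^ 2) (fun y => by simp [action])
    (fun θ => rfl) fun k' => ?_
  by_cases h : k' = k
  · subst h
    exact ⟨0, fun w => by simp [action]⟩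
  · exact ⟨‖x.a k‖ ^ 2, fun w => by simp [action, Ne.symm h, h]⟩

theorem ActionPreserving.of_sum_eq_zero {p : ℝ} {j : Fin b → NormalSite m} {l : Fin d → ℤ}
    {σ : Fin b → SignType} (hl : l = 0)
    (h : ∀ f : NormalSite m → ℝ, ∑ r, ((σ r : ℤ) : ℝ) * f (j r) = 0) :
    ActionPreserving p j l σ := by
  refine ⟨hl, fun k x _ => ?_⟩
  rw [poisson_monomial (hasActionGradient_action k x), h]
  simp

end Poisson

/-! ### Mass, momenta and the selection rules -/

section WeightedSums

variable {ι : Type*} {h : ι → ℤ × ℤ} {f : ℤ × ℤ → ℝ}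

theorem summable_mul_comp_of_finite_support (hh : Function.Injective h) (g : ι → ℝ)
    (hf : f.support.Finite) : Summable fun i => g i * f (h i) :=
  summable_of_hasFiniteSupport ((hf.preimage hh.injOn).subset fun i hi => by
    simp only [Function.mem_support] at hi
    exact right_ne_zero_of_mul hi)

theorem tsum_mul_comp_add_single (hh : Function.Injective h) (g : ι → ℝ)
    (hf : f.support.Finite) (k : ℤ × ℤ) (c : ℝ) :
    ∑' i, g i * (f + Pi.single k c : ℤ × ℤ → ℝ) (h i) =
      ∑' i, g i * f (h i) + (∑' i, g i * (Pi.single k 1 : ℤ × ℤ → ℝ) (h i)) * c := by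
  have hs : (Pi.single k 1 : ℤ × ℤ → ℝ).support.Finite :=
    (Set.finite_singleton k).subset Pi.support_single_subset
  rw [← tsum_mul_right, ← (summable_mul_comp_of_finite_support hh g hf).tsum_add
    ((summable_mul_comp_of_finite_support hh g hs).mul_right c)]
  refine tsum_congr fun i => ?_
  simp only [Pi.add_apply, Pi.single_apply]
  split_ifs <;> ring

theorem tsum_mul_single_of_mem (hh : Function.Injective h) (g : ι → ℝ) (i : ι) :
    ∑' i', g i' * (Pi.single (h i) 1 : ℤ × ℤ → ℝ) (h i') = g i := by
  rw [tsum_eq_single i fun i' hi' => by simp [hh.ne hi']]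
  simp

theorem tsum_mul_single_of_notMem (g : ι → ℝ) {k : ℤ × ℤ} (hk : ∀ i, h i ≠ k) :
    ∑' i', g i' * (Pi.single k 1 : ℤ × ℤ → ℝ) (h i') = 0 := by
  simp [hk]

end WeightedSums

section Momentum

variable {d : ℕ} {m : Fin d → ℤ}

theorem ampSq_update (x : PhasePoint m) (k : NormalSite m) (w : ℂ) :
    ampSq { x with a := Function.update x.a k w } =
      ampSq { x with a := Function.update x.a k 0 } + Pi.single k.1 (‖w‖ ^ 2) := by
  funext j
  by_cases hj : j ∈ tangentialSites m
  · have : j ≠ k.1 := fun h => k.2 (h ▸ hj)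
    simp [ampSq, hj, this]
  · by_cases hjk : (⟨j, hj⟩ : NormalSite m) = k
    · subst hjk
      simp [ampSq, hj]
    · have : j ≠ k.1 := fun h => hjk (Subtype.ext h)
      simp [ampSq, hj, hjk, this]

theorem finite_support_ampSq {x : PhasePoint m} (hx : x.a.support.Finite) :
    (ampSq x).support.Finite := by
  refine (hx.image Subtype.val).subset fun j hj => ?_
  by_cases h : j ∈ tangentialSites m
  · simp [ampSq, h] at hj
  · simp [ampSq, h] at hj
    exact ⟨⟨j, h⟩, hj, rfl⟩

/-- The point reflection exchanging the two halves of a circle. -/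
def circleReflection (m : Fin d → ℤ) (q : Fin d × Fin d) (j : ℤ × ℤ) : ℤ × ℤ :=
  (m q.1 + m q.2 - j.1, -j.2)

theorem circleReflection_involutive (m : Fin d → ℤ) (q : Fin d × Fin d) :
    Function.Involutive (circleReflection m q) := fun j => by
  simp [circleReflection]

theorem circleReflection_mem_circlePlus {q : Fin d × Fin d} {j : ℤ × ℤ} :
    circleReflection m q j ∈ circlePlus m q.1 q.2 ↔ j ∈ circleMinus m q.1 q.2 := by
  simp only [circleReflection, circlePlus, circleMinus, Set.mem_ofPred_eq]
  refine and_congr ⟨fun h => ?_, fun h => ?_⟩ (by omega) <;> linear_combination h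

open Classical in
/-- The coefficient of `|a_j|²` in the mass. -/
noncomputable def massWeight (m : Fin d → ℤ) (j : ℤ × ℤ) : ℝ :=
  if j ∈ regularSites m then 1 else 0

open Classical in
/-- The coefficient of `|a_j|²` in the `x`-momentum. -/
noncomputable def momentumXWeight (m : Fin d → ℤ) (j : ℤ × ℤ) : ℝ :=
  (if j ∈ regularSites m then (j.1 : ℝ) else 0) + ∑ q : Fin d × Fin d with q.1 < q.2,
    ((if j ∈ circlePlus m q.1 q.2 then (j.1 : ℝ) - m q.1 else 0) +
      if j ∈ circleMinus m q.1 q.2 then (j.1 : ℝ) - m q.2 else 0)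

theorem finite_support_update_zero {x : PhasePoint m} (hx : x.a.support.Finite)
    (k : NormalSite m) : (Function.update x.a k 0).support.Finite :=
  hx.subset fun j hj => by
    by_cases h : j = k
    · subst h
      simp at hj
    · simpa [h] using hj

/-- Finite support survives a change of one amplitude, so the infinite sums can be split without
convergence questions. -/
theorem hasActionGradient_of_ampSq {F : PhasePoint m → ℂ} {c : Fin d → ℝ} {W : ℤ × ℤ → ℝ}
    {Λ : (ℤ × ℤ → ℝ) → ℝ} (hF : ∀ x, F x = ((∑ i, c i * x.Y i + Λ (ampSq x) : ℝ) : ℂ))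
    (hΛ : ∀ f : ℤ × ℤ → ℝ, f.support.Finite → ∀ k : NormalSite m, ∀ t,
      Λ (f + Pi.single k.1 t) = Λ f + W k.1 * t)
    {x : PhasePoint m} (hx : x.a.support.Finite) :
    HasActionGradient F c (fun k => W k.1) x := by
  refine hasActionGradient_of_eq (B := Λ (ampSq x)) (fun y => hF _) (fun θ => ?_) fun k =>
    ⟨∑ i, c i * x.Y i + Λ (ampSq { x with a := Function.update x.a k 0 }), fun w => ?_⟩
  · rw [hF, hF]
    rfl
  · rw [hF, ampSq_update, hΛ _ (finite_support_ampSq (finite_support_update_zero hx k)), add_assoc]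

theorem hasActionGradient_mass {x : PhasePoint m} (hx : x.a.support.Finite) :
    HasActionGradient mass (fun _ => 1) (fun k => massWeight m k.1) x := by
  refine hasActionGradient_of_ampSq (W := massWeight m)
    (Λ := fun f => ∑' j : regularSites m, 1 * f j) (fun x => by simp [mass]) (fun f hf k t => ?_) hx
  rw [tsum_mul_comp_add_single Subtype.val_injective _ hf]
  congr 2
  by_cases hk : k.1 ∈ regularSites m
  · rw [massWeight, if_pos hk]
    exact tsum_mul_single_of_mem Subtype.val_injective (fun _ => 1) ⟨k.1, hk⟩
  · rw [massWeight, if_neg hk]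
    exact tsum_mul_single_of_notMem _ fun i h => hk (h ▸ i.2)

theorem hasActionGradient_momentumY {x : PhasePoint m} (hx : x.a.support.Finite) :
    HasActionGradient momentumY 0 (fun k => (k.1.2 : ℝ)) x := by
  refine hasActionGradient_of_ampSq (W := fun j => (j.2 : ℝ))
    (Λ := fun f => ∑' j : ℤ × ℤ, (j.2 : ℝ) * f j) (fun x => by simp [momentumY])
    (fun f hf k t => ?_) hx
  have h := tsum_mul_comp_add_single Function.injective_id (fun j : ℤ × ℤ => (j.2 : ℝ)) hf k.1 t
  have h2 := tsum_mul_single_of_mem Function.injective_id (fun j : ℤ × ℤ => (j.2 : ℝ)) k.1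
  simp only [id] at h h2
  rw [h, h2]

/-- On the lower half of a circle the weight comes from the reflected point: −((m_i + m_k − n₁) −
m_i) = n₁ − m_k, where n₁ is the first coordinate of the site. -/
theorem hasActionGradient_momentumX {x : PhasePoint m} (hx : x.a.support.Finite) :
    HasActionGradient momentumX (fun i => (m i : ℝ)) (fun k => momentumXWeight m k.1) x := by
  refine hasActionGradient_of_ampSq (W := momentumXWeight m)
    (Λ := fun f => ∑' j : regularSites m, (j.1.1 : ℝ) * f j +
      ∑ q : Fin d × Fin d with q.1 < q.2, ∑' j : circlePlus m q.1 q.2,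
        ((j.1.1 : ℝ) - m q.1) * (f j - f (circleReflection m q j)))
    (fun x => by simp only [momentumX, circleReflection, add_assoc]) (fun f hf k t => ?_) hx
  have hreg : ∑' j : regularSites m, (j.1.1 : ℝ) * (Pi.single k.1 1 : ℤ × ℤ → ℝ) j =
      open Classical in if k.1 ∈ regularSites m then (k.1.1 : ℝ) else 0 := by
    split_ifs with hk
    · exact tsum_mul_single_of_mem Subtype.val_injective
        (fun j : regularSites m => (j.1.1 : ℝ)) ⟨k.1, hk⟩
    · exact tsum_mul_single_of_notMem _ fun i h => hk (h ▸ i.2)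
  have hcirc : ∀ q : Fin d × Fin d, ∑' j : circlePlus m q.1 q.2,
      ((j.1.1 : ℝ) - m q.1) * ((f + Pi.single k.1 t : ℤ × ℤ → ℝ) j -
        (f + Pi.single k.1 t : ℤ × ℤ → ℝ) (circleReflection m q j)) =
      ∑' j : circlePlus m q.1 q.2,
        ((j.1.1 : ℝ) - m q.1) * (f j - f (circleReflection m q j)) +
      (open Classical in ((if k.1 ∈ circlePlus m q.1 q.2 then (k.1.1 : ℝ) - m q.1 else 0) +
        if k.1 ∈ circleMinus m q.1 q.2 then (k.1.1 : ℝ) - m q.2 else 0)) * t := by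
    intro q
    have hinj : Function.Injective fun j : circlePlus m q.1 q.2 => circleReflection m q j :=
      (circleReflection_involutive m q).injective.comp Subtype.val_injective
    have hft : (f + Pi.single k.1 t : ℤ × ℤ → ℝ).support.Finite :=
      (hf.union ((Set.finite_singleton k.1).subset Pi.support_single_subset)).subset
        (Function.support_add _ _)
    have hsub : ∀ f : ℤ × ℤ → ℝ, f.support.Finite → ∑' j : circlePlus m q.1 q.2,
        ((j.1.1 : ℝ) - m q.1) * (f j - f (circleReflection m q j)) =
        ∑' j : circlePlus m q.1 q.2, ((j.1.1 : ℝ) - m q.1) * f j -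
          ∑' j : circlePlus m q.1 q.2, ((j.1.1 : ℝ) - m q.1) * f (circleReflection m q j) := by
      intro f hf
      rw [← (summable_mul_comp_of_finite_support Subtype.val_injective
        (fun j : circlePlus m q.1 q.2 => (j.1.1 : ℝ) - m q.1) hf).tsum_sub
        (summable_mul_comp_of_finite_support hinj _ hf)]
      exact tsum_congr fun j => mul_sub _ _ _
    have h1 : ∑' j : circlePlus m q.1 q.2, ((j.1.1 : ℝ) - m q.1) *
        (Pi.single k.1 1 : ℤ × ℤ → ℝ) j =
        open Classical in if k.1 ∈ circlePlus m q.1 q.2 then (k.1.1 : ℝ) - m q.1 else 0 := by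
      split_ifs with hk
      · exact tsum_mul_single_of_mem Subtype.val_injective
          (fun j : circlePlus m q.1 q.2 => (j.1.1 : ℝ) - m q.1) ⟨k.1, hk⟩
      · exact tsum_mul_single_of_notMem _ fun i h => hk (h ▸ i.2)
    have h2 : ∑' j : circlePlus m q.1 q.2, ((j.1.1 : ℝ) - m q.1) *
        (Pi.single k.1 1 : ℤ × ℤ → ℝ) (circleReflection m q j) =
        open Classical in if k.1 ∈ circleMinus m q.1 q.2 then -((k.1.1 : ℝ) - m q.2) else 0 := by
      split_ifs with hk
      · have := tsum_mul_single_of_mem hinj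
          (fun j : circlePlus m q.1 q.2 => (j.1.1 : ℝ) - m q.1)
          ⟨_, circleReflection_mem_circlePlus.2 hk⟩
        simp only [circleReflection_involutive m q k.1] at this
        rw [this]
        simp [circleReflection]
        ring
      · exact tsum_mul_single_of_notMem _ fun i h => hk
          (circleReflection_mem_circlePlus.1
            (by rw [← h, circleReflection_involutive]; exact i.2))
    rw [hsub _ hft, hsub _ hf, tsum_mul_comp_add_single Subtype.val_injective _ hf,
      tsum_mul_comp_add_single hinj _ hf, h1, h2]
    split_ifs <;> ring
  simp only [hcirc]
  rw [tsum_mul_comp_add_single Subtype.val_injective _ hf, hreg, Finset.sum_add_distrib,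
    momentumXWeight, add_mul, Finset.sum_mul]
  ring

/-- The selection rules satisfied by admissible index tuples. -/
theorem Admissible.selection {b : ℕ} {p : ℝ} {j : Fin b → NormalSite m} {l : Fin d → ℤ}
    {σ : Fin b → SignType} (h : Admissible p j l σ) :
    ∑ i, (l i : ℝ) + ∑ r, ((σ r : ℤ) : ℝ) * massWeight m (j r).1 = 0 ∧
    ∑ i, (l i : ℝ) * m i + ∑ r, ((σ r : ℤ) : ℝ) * momentumXWeight m (j r).1 = 0 ∧
    ∑ r, ((σ r : ℤ) : ℝ) * ((j r).1.2 : ℝ) = 0 := by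
  classical
  -- Unit amplitudes on the sites of the triple make the monomial equal to 1, and the finite support
  -- puts x in every h^p.
  let x : PhasePoint m := ⟨0, 0, fun k => if k ∈ Finset.univ.image j then 1 else 0⟩
  have hx : x.a.support.Finite := (Finset.univ.image j).finite_toSet.subset fun k hk => by
    by_contra h
    exact hk (if_neg h)
  have hxp : InPhaseSpace p x := summable_of_hasFiniteSupport (hx.subset fun k hk => by
    simp only [Function.mem_support] at hk ⊢
    intro h0
    exact hk (by simp [h0]))
  have hM : monomial j l σ x ≠ 0 := by
    have hone : ∀ r, signPow (x.a (j r)) (σ r) = 1 := fun r => by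
      have : x.a (j r) = 1 := if_pos (Finset.mem_image_of_mem j (Finset.mem_univ r))
      rw [this]
      rcases σ r with _ | _ | _ <;> simp [signPow]
    simp [monomial, hone]
  have key : ∀ {F : PhasePoint m → ℂ} {c : Fin d → ℝ} {W : NormalSite m → ℝ},
      HasActionGradient F c W x → PoissonCommute p (monomial j l σ) F →
        ∑ i, (l i : ℝ) * c i + ∑ r, ((σ r : ℤ) : ℝ) * W (j r) = 0 := by
    intro F c W hF hcomm
    have h0 := hcomm x hxp
    rw [poisson_monomial hF] at h0
    have h1 := (mul_eq_zero.1 ((mul_eq_zero.1 h0).resolve_right hM)).resolve_left (by simp)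
    exact_mod_cast h1
  refine ⟨by simpa using key (hasActionGradient_mass hx) h.1,
    key (hasActionGradient_momentumX hx) h.2.1,
    by simpa using key (hasActionGradient_momentumY hx) h.2.2⟩

end Momentum

/-! ### Frequencies and momenta according to the kind of site -/

section Sites

variable {d : ℕ} {m : Fin d → ℤ}

/-- The site `j` is of the given kind. -/
def SiteType.Describes (m : Fin d → ℤ) (j : ℤ × ℤ) : SiteType d → Prop
  | regular => j ∈ regularSites m
  | vertical i => j.2 ≠ 0 ∧ j.1 = m i
  | plus i k => i < k ∧ j ∈ circlePlus m i k
  | minus i k => i < k ∧ j ∈ circleMinus m i k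

theorem SiteType.Describes.valid {j : ℤ × ℤ} {t : SiteType d} (h : t.Describes m j) :
    t.Valid := by
  cases t with
  | regular => trivial
  | vertical i => trivial
  | plus i k => exact h.1
  | minus i k => exact h.1

theorem exists_describes (j : NormalSite m) : ∃ t : SiteType d, t.Describes m j.1 := by
  by_cases h : j.1 ∈ regularSites m
  · exact ⟨.regular, h⟩
  · rw [regularSites, Set.notMem_compl_iff] at h
    rcases h with (h | ⟨h, i, hi⟩) | ⟨i, k, hik, h | h⟩
    · exact absurd h j.2
    · exact ⟨.vertical i, h, hi⟩
    · exact ⟨.plus i k, hik, h⟩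
    · exact ⟨.minus i k, hik, h⟩

/-- The part of the normal frequency that does not depend on the parameters. -/
def SiteType.freqConst (m : Fin d → ℤ) (j : ℤ × ℤ) : SiteType d → ℝ
  | regular => (j.1 : ℝ) ^ 2 + (j.2 : ℝ) ^ 2
  | vertical _ => (j.2 : ℝ) ^ 2
  | plus i _ => (j.1 : ℝ) ^ 2 + (j.2 : ℝ) ^ 2 - (m i : ℝ) ^ 2
  | minus _ k => (j.1 : ℝ) ^ 2 + (j.2 : ℝ) ^ 2 - (m k : ℝ) ^ 2

/-- The contribution of a site to the `x`-momentum. -/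
def SiteType.xWeight (m : Fin d → ℤ) (j : ℤ × ℤ) : SiteType d → ℝ
  | regular => j.1
  | vertical _ => 0
  | plus i _ => j.1 - m i
  | minus _ k => j.1 - m k

theorem IsGeneric.circle_unique (hg : IsGeneric m) {j : ℤ × ℤ} {i k i' k' : Fin d} (hik : i < k)
    (hik' : i' < k') (h : j ∈ circleSites m i k) (h' : j ∈ circleSites m i' k') :
    (i', k') = (i, k) := by
  by_contra hne
  exact Set.disjoint_left.1 (hg.2 i' k' i k hik' hik hne) h' h

theorem IsGeneric.notMem_vertical (hg : IsGeneric m) {j : ℤ × ℤ} {i k : Fin d} (hik : i < k)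
    (h : j ∈ circleSites m i k) : ¬ ∃ i : Fin d, j.2 ≠ 0 ∧ j.1 = m i := fun ⟨i', h1, h2⟩ =>
  Set.disjoint_left.1 hg.1 ⟨h1, i', h2⟩ ⟨i, k, hik, h⟩

/-- Genericity and the injectivity of m make the kind of a site unique, so the indices picked by
`choose` are the given ones. -/
theorem SiteType.Describes.normalFreq_eq (hm : StrictMono m) (hg : IsGeneric m) {j : ℤ × ℤ}
    {t : SiteType d} (h : t.Describes m j) (μ : Fin d → (Fin d → ℝ) → ℝ)
    (μp μm : Fin d → Fin d → (Fin d → ℝ) → ℝ) (ε : ℝ) (lam : Fin d → ℝ) :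
    normalFreq m μ μp μm ε lam j = t.freqConst m j + ε * t.root (fun i => μ i lam)
      (fun i k => μp i k lam) (fun i k => μm i k lam) := by
  unfold normalFreq
  cases t with
  | regular =>
    have h1 : ¬ ∃ i : Fin d, j.2 ≠ 0 ∧ j.1 = m i := fun ⟨i, h1, h2⟩ =>
      h (Or.inl (Or.inr ⟨h1, i, h2⟩))
    have h2 : ¬ ∃ q : Fin d × Fin d, q.1 < q.2 ∧ j ∈ circlePlus m q.1 q.2 := fun ⟨q, h1, h2⟩ =>
      h (Or.inr ⟨q.1, q.2, h1, Or.inl h2⟩)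
    have h3 : ¬ ∃ q : Fin d × Fin d, q.1 < q.2 ∧ j ∈ circleMinus m q.1 q.2 := fun ⟨q, h1, h2⟩ =>
      h (Or.inr ⟨q.1, q.2, h1, Or.inr h2⟩)
    rw [dif_neg h1, dif_neg h2, dif_neg h3]
    simp [freqConst, root]
  | vertical i =>
    have h1 : ∃ i : Fin d, j.2 ≠ 0 ∧ j.1 = m i := ⟨i, h⟩
    have h2 : h1.choose = i := hm.injective (h1.choose_spec.2.symm.trans h.2)
    rw [dif_pos h1, h2]
    simp [freqConst, root, add_comm]
  | plus i k =>
    have h1 : ∃ q : Fin d × Fin d, q.1 < q.2 ∧ j ∈ circlePlus m q.1 q.2 := ⟨(i, k), h⟩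
    have h2 : h1.choose = (i, k) :=
      hg.circle_unique h.1 h1.choose_spec.1 (Or.inl h.2) (Or.inl h1.choose_spec.2)
    rw [dif_neg (hg.notMem_vertical h.1 (Or.inl h.2)), dif_pos h1, h2]
    rfl
  | minus i k =>
    have h0 : ¬ ∃ q : Fin d × Fin d, q.1 < q.2 ∧ j ∈ circlePlus m q.1 q.2 := fun ⟨q, _, hq⟩ =>
      lt_asymm hq.2 h.2.2
    have h1 : ∃ q : Fin d × Fin d, q.1 < q.2 ∧ j ∈ circleMinus m q.1 q.2 := ⟨(i, k), h⟩
    have h2 : h1.choose = (i, k) :=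
      hg.circle_unique h.1 h1.choose_spec.1 (Or.inr h.2) (Or.inr h1.choose_spec.2)
    rw [dif_neg (hg.notMem_vertical h.1 (Or.inr h.2)), dif_neg h0, dif_pos h1, h2]
    simp [freqConst, root, sub_eq_add_neg]

theorem SiteType.Describes.notMem_regularSites {j : ℤ × ℤ} {t : SiteType d}
    (h : t.Describes m j) (ht : t ≠ .regular) : j ∉ regularSites m := by
  rw [regularSites, Set.notMem_compl_iff]
  cases t with
  | regular => exact absurd rfl ht
  | vertical i => exact Or.inl (Or.inr ⟨h.1, i, h.2⟩)
  | plus i k => exact Or.inr ⟨i, k, h.1, Or.inl h.2⟩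
  | minus i k => exact Or.inr ⟨i, k, h.1, Or.inr h.2⟩

theorem SiteType.Describes.massWeight_eq {j : ℤ × ℤ} {t : SiteType d}
    (h : t.Describes m j) : massWeight m j = if t = .regular then 1 else 0 := by
  by_cases ht : t = .regular
  · subst ht
    rw [massWeight, if_pos (show j ∈ regularSites m from h), if_pos rfl]
  · rw [massWeight, if_neg (h.notMem_regularSites ht), if_neg ht]

theorem SiteType.Describes.momentumXWeight_eq (hg : IsGeneric m) {j : ℤ × ℤ} {t : SiteType d}
    (h : t.Describes m j) : momentumXWeight m j = t.xWeight m j := by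
  classical
  unfold momentumXWeight
  cases t with
  | regular =>
    rw [if_pos (show j ∈ regularSites m from h), Finset.sum_eq_zero, add_zero]
    · rfl
    · intro q hq
      rw [if_neg fun hc => h (Or.inr ⟨q.1, q.2, (Finset.mem_filter.1 hq).2, Or.inl hc⟩),
        if_neg fun hc => h (Or.inr ⟨q.1, q.2, (Finset.mem_filter.1 hq).2, Or.inr hc⟩), add_zero]
  | vertical i =>
    rw [if_neg (h.notMem_regularSites (by simp)), Finset.sum_eq_zero, add_zero]
    · rfl
    · intro q hq
      rw [if_neg fun hc => hg.notMem_vertical (Finset.mem_filter.1 hq).2 (Or.inl hc) ⟨i, h⟩,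
        if_neg fun hc => hg.notMem_vertical (Finset.mem_filter.1 hq).2 (Or.inr hc) ⟨i, h⟩, add_zero]
  | plus i k =>
    have hmin : ∀ a b, j ∉ circleMinus m a b := fun a b hc => lt_asymm hc.2 h.2.2
    rw [if_neg (h.notMem_regularSites (by simp)), Finset.sum_eq_single (i, k), if_pos h.2,
      if_neg (hmin _ _), add_zero, zero_add]
    · rfl
    · intro q hq hne
      rw [if_neg fun hc => hne (hg.circle_unique h.1 (Finset.mem_filter.1 hq).2 (Or.inl h.2)
        (Or.inl hc)), if_neg (hmin _ _), add_zero]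
    · exact fun hn => absurd (Finset.mem_filter.2 ⟨Finset.mem_univ (i, k), h.1⟩) hn
  | minus i k =>
    have hplus : ∀ a b, j ∉ circlePlus m a b := fun a b hc => lt_asymm h.2.2 hc.2
    rw [if_neg (h.notMem_regularSites (by simp)), Finset.sum_eq_single (i, k), if_pos h.2,
      if_neg (hplus _ _), zero_add, zero_add]
    · rfl
    · intro q hq hne
      rw [if_neg (hplus _ _), if_neg fun hc => hne (hg.circle_unique h.1
        (Finset.mem_filter.1 hq).2 (Or.inr h.2) (Or.inr hc)), add_zero]
    · exact fun hn => absurd (Finset.mem_filter.2 ⟨Finset.mem_univ (i, k), h.1⟩) hn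

/-- Sites of the same kind with the same contributions to the momenta coincide. -/
theorem SiteType.Describes.eq_of_weights {j j' : ℤ × ℤ} {t : SiteType d} (h : t.Describes m j)
    (h' : t.Describes m j') (hx : t.xWeight m j = t.xWeight m j') (hy : j.2 = j'.2) : j = j' := by
  refine Prod.ext ?_ hy
  cases t with
  | regular =>
    simp only [xWeight] at hx
    exact_mod_cast hx
  | vertical i => exact h.2.trans h'.2.symm
  | plus i k =>
    have : (j.1 : ℝ) = j'.1 := by
      simp only [xWeight] at hx
      linarith
    exact_mod_cast this
  | minus i k =>
    have : (j.1 : ℝ) = j'.1 := by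
      simp only [xWeight] at hx
      linarith
    exact_mod_cast this

end Sites

/-! ### Combinatorics of the triple and conclusion -/

theorem sign_triple_of_sum_eq_zero : ∀ σ : Fin 3 → SignType, ∑ r, (σ r : ℤ) = 0 →
    (∀ r, σ r = 0) ∨ ∃ r s, r ≠ s ∧ ∀ k, σ k = if k = r then 1 else if k = s then -1 else 0 := by
  decide

/-- Counting the entries of each kind shows that the signs of an admissible triple cancel. -/
theorem sum_sign_eq_zero {d : ℕ} {l : Fin d → ℤ} {s : Fin 3 → ℤ} {T : Fin 3 → SiteType d}
    (hT : ∀ r, (T r).Valid) {c : ℤ} (hvert : ∀ i, typeCount s T (.vertical i) = c)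
    (hcirc : ∀ a b, a < b → typeCount s T (.plus a b) + typeCount s T (.minus a b) = 0)
    (hl : ∀ i, l i = c + ∑ k, (typeCount s T (.plus i k) - typeCount s T (.plus k i)))
    (hmass : ∑ i, l i + typeCount s T .regular = 0) : ∑ r, s r = 0 := by
  -- The circle terms of `hl` are antisymmetric and cancel in the sum over i.
  have h1 : ∑ i, l i = ∑ i, typeCount s T (.vertical i) := by
    simp only [hl, hvert, Finset.sum_add_distrib, Finset.sum_sub_distrib]
    rw [Finset.sum_comm (f := fun i k => typeCount s T (.plus k i)), sub_self, add_zero]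
  -- Formal roots with ρ = ν⁺ = 1 and ν⁻ = −1 give every site that is not regular the value 1, so
  -- the identity merely counts signs.
  have h2 := sum_root_eq s T (fun _ => 1) (fun _ _ => 1) fun _ _ => -1
  have h3 : ∀ a b, ((typeCount s T (.plus a b) : ℂ) * 1 -
      (typeCount s T (.minus a b) : ℂ) * -1) = 0 := by
    intro a b
    by_cases hab : a < b
    · have : (typeCount s T (.plus a b) : ℂ) + typeCount s T (.minus a b) = 0 := by
        exact_mod_cast hcirc a b hab
      simpa using this
    · simp [typeCount_plus_eq_zero s hT hab]
  simp only [h3, Finset.sum_const_zero, add_zero] at h2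
  have h4 : ∀ r, (s r : ℂ) =
      s r * (T r).root (fun _ => 1) (fun _ _ => 1) (fun _ _ => -1) +
        if T r = .regular then (s r : ℂ) else 0 :=
    fun r => by rcases T r with _ | _ | _ | _ <;> simp [SiteType.root]
  have h5 : (∑ r, (s r : ℂ)) = 0 := by
    rw [Finset.sum_congr rfl fun r _ => h4 r, Finset.sum_add_distrib, h2]
    rw [h1] at hmass
    simp only [typeCount, mul_one] at hmass ⊢
    exact_mod_cast hmass
  exact_mod_cast h5

/-- A pair of sites of the same kind or the exceptional pair of a regular and a vertical site are
the only ones compatible with the counts. -/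
theorem eq_or_of_typeCount {d : ℕ} {t u : SiteType d} (ht : t.Valid) (hu : u.Valid) {c : ℤ}
    (hvert : ∀ i, ((if t = .vertical i then 1 else 0) - if u = .vertical i then 1 else 0 : ℤ) = c)
    (hcirc : ∀ a b, a < b → ((if t = .plus a b then 1 else 0) - (if u = .plus a b then 1 else 0) +
      ((if t = .minus a b then 1 else 0) - if u = .minus a b then 1 else 0) : ℤ) = 0) :
    t = u ∨ (t = .regular ∧ ∃ i, u = .vertical i ∧ c = -1 ∧ ∀ k, k = i) ∨
      (u = .regular ∧ ∃ i, t = .vertical i ∧ c = 1 ∧ ∀ k, k = i) ∨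
      (∃ a b, t = .plus a b ∧ u = .minus a b) ∨ ∃ a b, t = .minus a b ∧ u = .plus a b := by
  rcases t with _ | i | ⟨a, b⟩ | ⟨a, b⟩ <;> rcases u with _ | i' | ⟨a', b'⟩ | ⟨a', b'⟩
  · exact Or.inl rfl
  · have hc := hvert i'
    simp at hc
    refine Or.inr (Or.inl ⟨rfl, i', rfl, hc.symm, fun k => ?_⟩)
    by_contra hk
    have := hvert k
    simp [Ne.symm hk] at this
    omega
  · simpa using hcirc a' b' hu
  · simpa using hcirc a' b' hu
  · have hc := hvert i
    simp at hc
    refine Or.inr (Or.inr (Or.inl ⟨rfl, i, rfl, hc.symm, fun k => ?_⟩))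
    by_contra hk
    have := hvert k
    simp [Ne.symm hk] at this
    omega
  · by_cases h : i = i'
    · exact Or.inl (by rw [h])
    · have h1 := hvert i
      have h2 := hvert i'
      simp [h, Ne.symm h] at h1 h2
      omega
  · simpa using hcirc a' b' hu
  · simpa using hcirc a' b' hu
  · simpa using hcirc a b ht
  · simpa using hcirc a b ht
  · have h := hcirc a b ht
    by_cases hab : a' = a ∧ b' = b
    · exact Or.inl (by rw [hab.1, hab.2])
    · simp [hab] at h
  · have h := hcirc a b ht
    by_cases hab : a' = a ∧ b' = b
    · exact Or.inr (Or.inr (Or.inr (Or.inl ⟨a, b, rfl, by rw [hab.1, hab.2]⟩)))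
    · simp [hab] at h
  · simpa using hcirc a b ht
  · simpa using hcirc a b ht
  · have h := hcirc a b ht
    by_cases hab : a' = a ∧ b' = b
    · exact Or.inr (Or.inr (Or.inr (Or.inr ⟨a, b, rfl, by rw [hab.1, hab.2]⟩)))
    · simp [hab] at h
  · have h := hcirc a b ht
    by_cases hab : a' = a ∧ b' = b
    · exact Or.inl (by rw [hab.1, hab.2])
    · simp [hab] at h

/-- A regular site cannot be paired with a vertical one over the only tangential site. -/
theorem SiteType.Describes.false_of_regular_of_vertical {d : ℕ} {m : Fin d → ℤ} {j j' : ℤ × ℤ}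
    {i : Fin d} (h : (SiteType.regular : SiteType d).Describes m j)
    (h' : (SiteType.vertical i).Describes m j') (hx : j.1 = m i) (hy : j.2 = j'.2) : False :=
  h (Or.inl (Or.inr ⟨hy ▸ h'.1, i, hx⟩))

end FiniteGap

/-- The resonance functions of admissible triples that are not action preserving do not vanish
identically. Since the roots satisfy no unexpected integer linear relations, only the disjointness
conditions of genericity are used, and `L = 0` suffices. -/
theorem mainTheorem10 (d : ℕ) :
    ∃ L : ℕ, ∀ m : Fin d → ℤ, StrictMono m → FiniteGap.IsLGeneric m L →
      ∀ p : ℝ, 1 < p →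
      ∀ (O₁ : Set (Fin d → ℝ)) (μ : Fin d → (Fin d → ℝ) → ℝ)
        (μp μm : Fin d → Fin d → (Fin d → ℝ) → ℝ),
        FiniteGap.IsParameterDomain O₁ μ μp μm →
      ∀ ε : ℝ, 0 < ε →
      ∀ (j : Fin 3 → FiniteGap.NormalSite m) (l : Fin d → ℤ) (σ : Fin 3 → SignType),
        FiniteGap.Admissible p j l σ → ¬ FiniteGap.ActionPreserving p j l σ →
        ∃ lam ∈ O₁,
          ∑ i, FiniteGap.omega m ε lam i * (l i : ℝ)
            + ((σ 0 : ℤ) : ℝ) * FiniteGap.normalFreq m μ μp μm ε lam (j 0)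
            + ((σ 1 : ℤ) : ℝ) * FiniteGap.normalFreq m μ μp μm ε lam (j 1)
            + ((σ 2 : ℤ) : ℝ) * FiniteGap.normalFreq m μ μp μm ε lam (j 2) ≠ 0 := by
  refine ⟨0, fun m hm hgen p _ O₁ μ μp μm hdom ε hε j l σ hadm hnap => ?_⟩
  have hg := hgen.1
  by_contra! hzero
  apply hnap
  choose T hT using fun r => FiniteGap.exists_describes (j r)
  have hV : ∀ r, (T r).Valid := fun r => (hT r).valid
  set s : Fin 3 → ℤ := fun r => (σ r : ℤ) with hs
  obtain ⟨hmass, hx, hy⟩ := hadm.selection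
  simp only [fun r => (hT r).massWeight_eq] at hmass
  simp only [fun r => (hT r).momentumXWeight_eq hg] at hx
  -- Dividing by ε removes it from the λ-dependent part; only the constant still depends on it.
  set κ : ℝ := (∑ i, (m i : ℝ) ^ 2 * l i + ∑ r, (s r : ℝ) * (T r).freqConst m (j r)) / ε with hκ
  have hrel : ∀ lam ∈ O₁, κ - ∑ i, (l i : ℝ) * lam i + ∑ r, (s r : ℝ) *
      (T r).root (fun i => μ i lam) (fun i k => μp i k lam) (fun i k => μm i k lam) = 0 := by
    intro lam hlam
    have h0 := hzero lam hlam
    simp only [fun r => (hT r).normalFreq_eq hm hg] at h0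
    have h1 : ∑ i, FiniteGap.omega m ε lam i * (l i : ℝ) =
        ∑ i, (m i : ℝ) ^ 2 * l i - ε * ∑ i, (l i : ℝ) * lam i := by
      rw [Finset.mul_sum, ← Finset.sum_sub_distrib]
      exact Finset.sum_congr rfl fun i _ => by rw [FiniteGap.omega]; ring
    rw [h1] at h0
    have h2 : ε * κ = ∑ i, (m i : ℝ) ^ 2 * l i + ∑ r, (s r : ℝ) * (T r).freqConst m (j r) :=
      mul_div_cancel₀ _ hε.ne'
    refine (mul_eq_zero.1 (?_ : ε * _ = 0)).resolve_left hε.ne'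
    rw [mul_add, mul_sub, h2, ← h0]
    simp only [Fin.sum_univ_three, hs]
    ring
  have hC := hdom.exists_complex_relation κ l s T hV hrel
  have hκ0 := FiniteGap.constant_eq_zero_of_relation hV hC
  have H : ∀ z : Fin d → ℂ, ∃ ρ νp νm, FiniteGap.IsRootSystem z ρ νp νm ∧
      ∑ r, (s r : ℂ) * (T r).root ρ νp νm = ∑ i, (l i : ℂ) * z i := fun z => by
    obtain ⟨ρ, νp, νm, h1, h2⟩ := hC z
    refine ⟨ρ, νp, νm, h1, ?_⟩
    rw [hκ0, Complex.ofReal_zero] at h2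
    linear_combination h2
  have hcirc := fun a b (hab : a < b) => FiniteGap.typeCount_plus_add_minus hV H hab
  obtain ⟨c, hvert, hl⟩ := FiniteGap.typeCount_of_relation hV H
  have hsum : ∑ r, s r = 0 := by
    refine FiniteGap.sum_sign_eq_zero hV hvert hcirc hl ?_
    simp only [mul_ite, mul_one, mul_zero] at hmass
    simp only [FiniteGap.typeCount]
    exact_mod_cast hmass
  rcases FiniteGap.sign_triple_of_sum_eq_zero σ hsum with hσ | ⟨r, q, hrq, hσ⟩
  · have hcount : ∀ t, FiniteGap.typeCount s T t = 0 := fun t =>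
      Finset.sum_eq_zero fun r _ => by simp [hs, hσ]
    refine FiniteGap.ActionPreserving.of_sum_eq_zero (funext fun i => ?_) fun f => by simp [hσ]
    rw [hl, ← hvert i]
    simp [hcount]
  have hpair : ∀ f : Fin 3 → ℝ, ∑ k, ((σ k : ℤ) : ℝ) * f k = f r - f q := fun f => by
    rw [Finset.sum_eq_add r q hrq (fun k _ hk => by simp [hσ k, hk.1, hk.2]) (by simp) (by simp)]
    simp [hσ, hrq.symm, sub_eq_add_neg]
  have hcount : ∀ t, FiniteGap.typeCount s T t =
      (if T r = t then 1 else 0) - if T q = t then 1 else 0 := fun t => by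
    have := hpair fun k => if T k = t then 1 else 0
    simp only [mul_ite, mul_one, mul_zero] at this
    simp only [FiniteGap.typeCount, hs]
    exact_mod_cast this
  rw [hpair] at hx hy
  have hy' : (j r).1.2 = (j q).1.2 := by exact_mod_cast sub_eq_zero.1 hy
  have hTr := hT r
  have hTq := hT q
  -- Equal kinds force ℓ = 0. A regular and a vertical site have constant vertical counts only if d
  -- = 1. Otherwise the two sites lie on opposite halves of one circle.
  rcases FiniteGap.eq_or_of_typeCount (hV r) (hV q) (fun i => (hcount _).symm.trans (hvert i))
    (fun a b hab => by rw [← hcount, ← hcount]; exact hcirc a b hab) with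
    heq | ⟨h1, i, h2, hc, hi⟩ | ⟨h1, i, h2, hc, hi⟩ | ⟨a, b, h1, h2⟩ | ⟨a, b, h1, h2⟩
  · have hl0 : l = 0 := funext fun i => by
      rw [hl, ← hvert i]
      simp [hcount, heq]
    have hj : j r = j q := by
      rw [heq] at hTr hx
      refine Subtype.ext (hTr.eq_of_weights hTq ?_ hy')
      simpa [hl0, sub_eq_zero] using hx
    exact FiniteGap.ActionPreserving.of_sum_eq_zero hl0 fun f => by
      rw [hpair fun k => f (j k), hj, sub_self]
  -- With ℓ_i = −1 the x-momentum puts the regular site on the line over m_i, at the nonzero height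
  -- of the vertical one, so it would be vertical itself.
  · exfalso
    have hli : l i = -1 := by
      rw [hl, hc]
      simp [hcount, h1, h2]
    rw [Finset.sum_eq_single i (fun k _ hk => absurd (hi k) hk) (by simp), hli, h1, h2] at hx
    rw [h1] at hTr
    rw [h2] at hTq
    refine hTr.false_of_regular_of_vertical hTq ?_ hy'
    simp only [FiniteGap.SiteType.xWeight] at hx
    have : ((j r).1.1 : ℝ) = m i := by
      push_cast at hx
      linarith
    exact_mod_cast this
  · exfalso
    have hli : l i = 1 := by
      rw [hl, hc]
      simp [hcount, h1, h2]
    rw [Finset.sum_eq_single i (fun k _ hk => absurd (hi k) hk) (by simp), hli, h1, h2] at hx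
    rw [h1] at hTq
    rw [h2] at hTr
    refine hTq.false_of_regular_of_vertical hTr ?_ hy'.symm
    simp only [FiniteGap.SiteType.xWeight] at hx
    have : ((j q).1.1 : ℝ) = m i := by
      push_cast at hx
      linarith
    exact_mod_cast this
  -- Equal second coordinates are impossible on opposite halves of a circle.
  · rw [h1] at hTr
    rw [h2] at hTq
    exact absurd hy' (hTq.2.2.trans hTr.2.2).ne'
  · rw [h1] at hTr
    rw [h2] at hTq
    exact absurd hy' (hTr.2.2.trans hTq.2.2).ne
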